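/- Let $d\in\mathbb{N}_0$ and $p,q\in[1,\infty]$. Fix a mollifier $\phi\in\mathcal{S}(\mathbb{R}^d)$ with $\int\phi(x)\,dx=1$ and $\int x^\alpha\phi(x)\,dx=0$ for all multi-indices $\alpha\neq 0$, and put $\phi_\varepsilon=\varepsilon^{-d}\phi(\cdot/\varepsilon)$ for $\varepsilon\in(0,1)$. For a smooth function $f$ and an open set $\omega\subseteq\mathbb{R}^d$ let $\|f\|_{W^{k,p}(\omega)}=\max_{|\alpha|\le k}\|\partial^\alpha f\|_{L^p(\omega)}$. Let $\mathcal{E}_q(\mathbb{R}^d)$ be the space of nets $(f_\varepsilon)_{\varepsilon\in(0,1)}$ of smooth complex valued functions on $\mathbb{R}^d$ such that $\varepsilon\mapsto f_\varepsilon$ is continuous from $(0,1)$ to $C^\infty(\mathbb{R}^d)$ and such that for every $k\in\mathbb{N}_0$ and every relatively compact open $\omega\subset\mathbb{R}^d$ there is $s\in\mathbb{R}$ with $\int_0^1\varepsilon^{qs}\|f_\varepsilon\|_{W^{k,p}(\omega)}^q\frac{d\varepsilon}{\varepsilon}<\infty$. For $k\in\mathbb{N}_0$ and $s\in\mathbb{R}$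 let $\mathcal{E}^{k,-s}_{q,L^p}(\mathbb{R}^d)$ be the space of nets $(f_\varepsilon)_\varepsilon\in\mathcal{E}_q(\mathbb{R}^d)$ with $\int_0^1\varepsilon^{qs}\|f_\varepsilon\|_{W^{k,p}(\mathbb{R}^d)}^q\frac{d\varepsilon}{\varepsilon}<\infty$. If $q=\infty$, both integral conditions are replaced by $\sup_{\varepsilon\in(0,1)}\varepsilon^{s}\|f_\varepsilon\|_{W^{k,p}}<\infty$ (over $\omega$, respectively $\mathbb{R}^d$). Put $$\mathcal{E}_{q,L^p}=\bigcap_{k}\bigcup_{s}\mathcal{E}^{k,-s}_{q,L^p},\qquad \mathcal{N}_{q,L^p}=\bigcap_{k,s}\mathcal{E}^{k,-s}_{q,L^p},\qquad \mathcal{G}_{q,L^p}=\mathcal{E}_{q,L^p}/\mathcal{N}_{q,L^p}.$$ Finally, let $\mathcal{D}'_{L^p}(\mathbb{R}^d)=\bigcup_{k\in\mathbb{N}_0}W^{-k,p}_0(\mathbb{R}^d)\subseteq\mathcal{S}'(\mathbb{R}^d)$, where $W^{-k,p}_0(\mathbb{R}^d)$ is the dual of $W^{k,p'}_0(\mathbb{R}^d)$,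 the closure of the test functions in $W^{k,p'}(\mathbb{R}^d)$, with $\frac1p+\frac1{p'}=1$; that is, $T\in W^{-k,p}_0(\mathbb{R}^d)$ if and only if there is $C\geq 0$ with $|\langle T,g\rangle|\le C\|g\|_{W^{k,p'}(\mathbb{R}^d)}$ for all $g\in\mathcal{S}(\mathbb{R}^d)$. Then: (i) If $T\in\mathcal{S}'(\mathbb{R}^d)$ and the net $(T*\phi_\varepsilon)_\varepsilon$ belongs to $\mathcal{E}_{q,L^p}(\mathbb{R}^d)$, then $T\in\mathcal{D}'_{L^p}(\mathbb{R}^d)$. (ii) $\mathcal{D}'_{L^p}(\mathbb{R}^d)$ is the largest linear subspace of $\mathcal{S}'(\mathbb{R}^d)$ that embeds into $\mathcal{G}_{q,L^p}(\mathbb{R}^d)$ by mollification. That is, for $V=\mathcal{D}'_{L^p}(\mathbb{R}^d)$ the nets $(T*\phi_\varepsilon)_\varepsilon$, $T\in V$, all belong to $\mathcal{E}_{q,L^p}(\mathbb{R}^d)$ and the linear map $V\to\mathcal{G}_{q,L^p}(\mathbb{R}^d)$, $T\mapsto[(T*\phi_\varepsilon)_\varepsilon]$, is injective; and every linear subspace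 $V$ of $\mathcal{S}'(\mathbb{R}^d)$ with these two properties is contained in $\mathcal{D}'_{L^p}(\mathbb{R}^d)$. -/

import Mathlib

open MeasureTheory Set
open scoped ENNReal NNReal SchwartzMap

noncomputable section

namespace QColombeau

/-- `ℝ^d` with its Euclidean structure and Lebesgue measure. -/
abbrev Space (d : ℕ) := EuclideanSpace ℝ (Fin d)

/-- Nets `(f_ε)_{ε ∈ (0,1)}` of complex valued functions on `ℝ^d`. -/
abbrev Net (d : ℕ) := Ioo (0 : ℝ) 1 → Space d → ℂ

variable {d : ℕ}

/-- The iterated partial derivative `∂_{v 0} ⋯ ∂_{v (n - 1)} f`. -/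
def partialDeriv {n : ℕ} (v : Fin n → Fin d) (f : Space d → ℂ) (x : Space d) : ℂ :=
  iteratedFDeriv ℝ n f x (fun i => EuclideanSpace.single (v i) (1 : ℝ))

/-- The Sobolev norm `‖f‖_{W^{k,p}(ω)}`, the maximum of the `L^p(ω)`-norms of the partial
derivatives of order at most `k`, for a smooth function `f`. The families `v` of `n ≤ k`
coordinate directions run through all partial derivatives of order at most `k`. -/
def sobolevNorm (k : ℕ) (p : ℝ≥0∞) (ω : Set (Space d)) (f : Space d → ℂ) : ℝ≥0∞ :=
  ⨆ (n : Fin (k + 1)) (v : Fin n → Fin d), eLpNorm (partialDeriv v f) p (volume.restrict ω)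

/-- The quantity `∫_0^1 ε^{qs} N(ε)^q dε/ε` for `q < ∞`, and `sup_{0<ε<1} ε^s N(ε)` for
`q = ∞`. -/
def growth (q : ℝ≥0∞) (s : ℝ) (N : Ioo (0 : ℝ) 1 → ℝ≥0∞) : ℝ≥0∞ :=
  if q = ∞ then ⨆ ε : Ioo (0 : ℝ) 1, ENNReal.ofReal ((ε : ℝ) ^ s) * N ε
  else ∫⁻ ε : Ioo (0 : ℝ) 1,
    ENNReal.ofReal ((ε : ℝ) ^ (q.toReal * s)) * N ε ^ q.toReal * ENNReal.ofReal (1 / (ε : ℝ))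
      ∂(volume.comap Subtype.val)

/-- `ε ↦ f_ε` is a continuous map from `(0,1)` to `C^∞(ℝ^d)`: each `f_ε` is smooth, and all
derivatives in `x` are continuous in `(ε, x)`. -/
def IsSmoothNet (f : Net d) : Prop :=
  (∀ ε, ContDiff ℝ (⊤ : ℕ∞) (f ε)) ∧
    ∀ n : ℕ, Continuous fun z : Ioo (0 : ℝ) 1 × Space d => iteratedFDeriv ℝ n (f z.1) z.2

/-! ### Helper facts -/

lemma IsSmoothNet.add {f g : Net d} (hf : IsSmoothNet f) (hg : IsSmoothNet g) :
    IsSmoothNet (f + g) := by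
  refine ⟨fun ε => (hf.1 ε).add (hg.1 ε), fun n => ?_⟩
  refine ((hf.2 n).add (hg.2 n)).congr fun z => ?_
  exact (iteratedFDeriv_add_apply (((hf.1 z.1).of_le (by exact_mod_cast le_top)).contDiffAt)
    (((hg.1 z.1).of_le (by exact_mod_cast le_top)).contDiffAt)).symm

lemma IsSmoothNet.smul {f : Net d} (c : ℂ) (hf : IsSmoothNet f) : IsSmoothNet (c • f) := by
  refine ⟨fun ε => (hf.1 ε).const_smul c, fun n => ?_⟩
  refine ((hf.2 n).const_smul c).congr fun z => ?_
  exact (iteratedFDeriv_const_smul_apply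
    (((hf.1 z.1).of_le (by exact_mod_cast le_top)).contDiffAt)).symm

lemma isSmoothNet_zero : IsSmoothNet (0 : Net d) := by
  refine ⟨fun ε => contDiff_const, fun n => ?_⟩
  refine (continuous_const (y := 0)).congr fun z => ?_
  exact (congrFun (iteratedFDeriv_fun_zero (𝕜 := ℝ) (E := Space d) (F := ℂ) (n := n)) z.2).symm

lemma partialDeriv_add {n : ℕ} (v : Fin n → Fin d) {f g : Space d → ℂ} (hf : ContDiff ℝ (⊤ : ℕ∞) f)
    (hg : ContDiff ℝ (⊤ : ℕ∞) g) : partialDeriv v (f + g) = partialDeriv v f + partialDeriv v g := by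
  ext x
  simp only [partialDeriv, Pi.add_apply]
  rw [iteratedFDeriv_add_apply ((hf.of_le (by exact_mod_cast le_top)).contDiffAt)
    ((hg.of_le (by exact_mod_cast le_top)).contDiffAt)]
  rfl

lemma partialDeriv_smul {n : ℕ} (v : Fin n → Fin d) (c : ℂ) {f : Space d → ℂ}
    (hf : ContDiff ℝ (⊤ : ℕ∞) f) : partialDeriv v (c • f) = c • partialDeriv v f := by
  ext x
  simp only [partialDeriv, Pi.smul_apply]
  rw [iteratedFDeriv_const_smul_apply ((hf.of_le (by exact_mod_cast le_top)).contDiffAt)]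
  rfl

lemma partialDeriv_zero {n : ℕ} (v : Fin n → Fin d) :
    partialDeriv v (0 : Space d → ℂ) = 0 := by
  simpa using partialDeriv_smul v 0 (f := 0) contDiff_const

lemma continuous_partialDeriv {n : ℕ} (v : Fin n → Fin d) {f : Space d → ℂ}
    (hf : ContDiff ℝ (⊤ : ℕ∞) f) : Continuous (partialDeriv v f) :=
  (hf.continuous_iteratedFDeriv (m := n) (by exact_mod_cast le_top)).eval_const _

lemma sobolevNorm_add_le (k : ℕ) (p : ℝ≥0∞) (ω : Set (Space d)) {f g : Space d → ℂ}
    (hf : ContDiff ℝ (⊤ : ℕ∞) f) (hg : ContDiff ℝ (⊤ : ℕ∞) g) :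
    sobolevNorm k p ω (f + g) ≤
      ENNReal.LpAddConst p * (sobolevNorm k p ω f + sobolevNorm k p ω g) := by
  refine iSup₂_le fun n v => ?_
  rw [partialDeriv_add v hf hg]
  refine (eLpNorm_add_le' (continuous_partialDeriv v hf).aestronglyMeasurable
    (continuous_partialDeriv v hg).aestronglyMeasurable p).trans ?_
  gcongr
  · exact le_iSup₂ (f := fun (n : Fin (k + 1)) (v : Fin n → Fin d) =>
      eLpNorm (partialDeriv v f) p (volume.restrict ω)) n v
  · exact le_iSup₂ (f := fun (n : Fin (k + 1)) (v : Fin n → Fin d) =>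
      eLpNorm (partialDeriv v g) p (volume.restrict ω)) n v

lemma sobolevNorm_smul_le (k : ℕ) (p : ℝ≥0∞) (ω : Set (Space d)) (c : ℂ) {f : Space d → ℂ}
    (hf : ContDiff ℝ (⊤ : ℕ∞) f) :
    sobolevNorm k p ω (c • f) ≤ ‖c‖ₑ * sobolevNorm k p ω f := by
  refine iSup₂_le fun n v => ?_
  rw [partialDeriv_smul v c hf, eLpNorm_const_smul]
  gcongr
  exact le_iSup₂ (f := fun (n : Fin (k + 1)) (v : Fin n → Fin d) =>
      eLpNorm (partialDeriv v f) p (volume.restrict ω)) n v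

lemma sobolevNorm_zero (k : ℕ) (p : ℝ≥0∞) (ω : Set (Space d)) :
    sobolevNorm k p ω (0 : Space d → ℂ) = 0 := by
  simp [sobolevNorm, partialDeriv_zero]

lemma sobolevNorm_mono {k l : ℕ} (h : k ≤ l) (p : ℝ≥0∞) (ω : Set (Space d)) (f : Space d → ℂ) :
    sobolevNorm k p ω f ≤ sobolevNorm l p ω f := by
  refine iSup₂_le fun n v => ?_
  exact le_iSup₂ (f := fun (n : Fin (l + 1)) (v : Fin n → Fin d) =>
      eLpNorm (partialDeriv v f) p (volume.restrict ω)) ⟨n, by omega⟩ v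

lemma measurable_eLpNorm_param {X : Type*} [MeasurableSpace X] (p : ℝ≥0∞)
    (μ : Measure (Space d)) [SFinite μ] {h : X × Space d → ℂ} (hh : Measurable h) :
    Measurable fun t => eLpNorm (fun x => h (t, x)) p μ := by
  rcases eq_or_ne p 0 with rfl | hp0
  · simp
  rcases eq_or_ne p ∞ with rfl | hp
  · simp only [eLpNorm_exponent_top]
    refine measurable_of_Iic fun c => ?_
    have hset : MeasurableSet {z : X × Space d | c < ‖h z‖ₑ} :=
      measurableSet_lt measurable_const hh.enorm
    have key := measurable_measure_prodMk_left (ν := μ) hset (measurableSet_singleton 0)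
    convert key using 1
    ext t
    simp only [mem_preimage, mem_Iic, mem_singleton_iff]
    constructor
    · intro hc
      have := ae_le_eLpNormEssSup (f := fun x => h (t, x)) (μ := μ)
      refine measure_mono_null (fun x hx => ?_) (ae_iff.1 this)
      exact not_le.2 (lt_of_le_of_lt hc hx)
    · intro h0
      refine essSup_le_of_ae_le c (ae_iff.2 (measure_mono_null (fun x hx => ?_) h0))
      exact not_le.1 hx
  · simp only [eLpNorm_eq_lintegral_rpow_enorm_toReal hp0 hp]
    exact (Measurable.lintegral_prod_right' (f := fun z => ‖h z‖ₑ ^ p.toReal)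
      (hh.enorm.pow_const _)).pow_const _

lemma IsSmoothNet.measurable_sobolevNorm {f : Net d} (hf : IsSmoothNet f) (k : ℕ) (p : ℝ≥0∞)
    (ω : Set (Space d)) : Measurable fun ε => sobolevNorm k p ω (f ε) := by
  refine Measurable.iSup fun n => Measurable.iSup fun v => ?_
  exact measurable_eLpNorm_param p (volume.restrict ω)
    (h := fun z => partialDeriv v (f z.1) z.2) ((hf.2 n).eval_const _).measurable

lemma growth_mono_fun (q : ℝ≥0∞) (s : ℝ) {N M : Ioo (0 : ℝ) 1 → ℝ≥0∞} (h : ∀ ε, N ε ≤ M ε) :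
    growth q s N ≤ growth q s M := by
  unfold growth
  split_ifs
  · exact iSup_mono fun ε => by gcongr; exact h ε
  · refine lintegral_mono fun ε => ?_
    dsimp only
    gcongr
    exact h ε

lemma growth_anti (q : ℝ≥0∞) {s t : ℝ} (hst : s ≤ t) (N : Ioo (0 : ℝ) 1 → ℝ≥0∞) :
    growth q t N ≤ growth q s N := by
  unfold growth
  split_ifs
  · refine iSup_mono fun ε => ?_
    gcongr ENNReal.ofReal ?_ * _
    exact Real.rpow_le_rpow_of_exponent_ge ε.2.1 ε.2.2.le hst
  · refine lintegral_mono fun ε => ?_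
    dsimp only
    gcongr ENNReal.ofReal ?_ * _ * _
    exact Real.rpow_le_rpow_of_exponent_ge ε.2.1 ε.2.2.le
      (mul_le_mul_of_nonneg_left hst ENNReal.toReal_nonneg)

lemma growth_const_mul_lt_top (q : ℝ≥0∞) (s : ℝ) {N : Ioo (0 : ℝ) 1 → ℝ≥0∞} {c : ℝ≥0∞}
    (hc : c ≠ ∞) (hN : growth q s N < ∞) : growth q s (fun ε => c * N ε) < ∞ := by
  unfold growth at *
  split_ifs at * with hq
  · have : ∀ ε : Ioo (0 : ℝ) 1, ENNReal.ofReal ((ε : ℝ) ^ s) * (c * N ε)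
        = c * (ENNReal.ofReal ((ε : ℝ) ^ s) * N ε) := fun ε => by ring
    simp only [this, ← ENNReal.mul_iSup]
    exact ENNReal.mul_lt_top hc.lt_top hN
  · have : ∀ ε : Ioo (0 : ℝ) 1, ENNReal.ofReal ((ε : ℝ) ^ (q.toReal * s)) * (c * N ε) ^ q.toReal
          * ENNReal.ofReal (1 / (ε : ℝ))
        = c ^ q.toReal * (ENNReal.ofReal ((ε : ℝ) ^ (q.toReal * s)) * N ε ^ q.toReal
          * ENNReal.ofReal (1 / (ε : ℝ))) := fun ε => by
      rw [ENNReal.mul_rpow_of_nonneg _ _ ENNReal.toReal_nonneg]; ring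
    have hcq : c ^ q.toReal ≠ ∞ := ENNReal.rpow_ne_top_of_nonneg ENNReal.toReal_nonneg hc
    simp only [this]
    rw [lintegral_const_mul' _ _ hcq]
    exact ENNReal.mul_lt_top hcq.lt_top hN

lemma growth_add_lt_top (q : ℝ≥0∞) (s : ℝ) {N M : Ioo (0 : ℝ) 1 → ℝ≥0∞} (hNm : Measurable N)
    (hN : growth q s N < ∞) (hM : growth q s M < ∞) : growth q s (fun ε => N ε + M ε) < ∞ := by
  have h2 : growth q s (fun ε => N ε ⊔ M ε) < ∞ := by
    unfold growth at *
    split_ifs at * with hq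
    · refine lt_of_le_of_lt (iSup_le fun ε => ?_) (ENNReal.add_lt_top.2 ⟨hN, hM⟩)
      dsimp only
      rcases le_total (N ε) (M ε) with h | h
      · rw [sup_eq_right.2 h]
        exact (le_iSup (fun ε : Ioo (0 : ℝ) 1 => ENNReal.ofReal ((ε : ℝ) ^ s) * M ε) ε).trans
          le_add_self
      · rw [sup_eq_left.2 h]
        exact (le_iSup (fun ε : Ioo (0 : ℝ) 1 => ENNReal.ofReal ((ε : ℝ) ^ s) * N ε) ε).trans
          le_self_add
    · have hm : Measurable fun ε : Ioo (0 : ℝ) 1 => ENNReal.ofReal ((ε : ℝ) ^ (q.toReal * s))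
          * N ε ^ q.toReal * ENNReal.ofReal (1 / (ε : ℝ)) := by fun_prop
      refine lt_of_le_of_lt ?_ (ENNReal.add_lt_top.2 ⟨hN, hM⟩)
      rw [← lintegral_add_left hm]
      refine lintegral_mono fun ε => ?_
      dsimp only
      rcases le_total (N ε) (M ε) with h | h
      · rw [sup_eq_right.2 h]; exact le_add_self
      · rw [sup_eq_left.2 h]; exact le_self_add
  refine lt_of_le_of_lt (growth_mono_fun q s fun ε => ?_)
    (growth_const_mul_lt_top q s (c := 2) (by norm_num) h2)
  rw [two_mul]
  exact add_le_add le_sup_left le_sup_right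

lemma growth_zero {q : ℝ≥0∞} (hq : 1 ≤ q) (s : ℝ) : growth q s (fun _ => 0) = 0 := by
  unfold growth
  split_ifs with h
  · simp
  · have : 0 < q.toReal := ENNReal.toReal_pos (zero_lt_one.trans_le hq).ne' h
    simp [this]

lemma growth_sobolevNorm_add {p q : ℝ≥0∞} {k : ℕ} {s t : ℝ} {ω : Set (Space d)} {f g : Net d}
    (hf : IsSmoothNet f) (hg : IsSmoothNet g)
    (h₁ : growth q s (fun ε => sobolevNorm k p ω (f ε)) < ∞)
    (h₂ : growth q t (fun ε => sobolevNorm k p ω (g ε)) < ∞) :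
    growth q (max s t) (fun ε => sobolevNorm k p ω ((f + g) ε)) < ∞ := by
  refine lt_of_le_of_lt (growth_mono_fun _ _ fun ε =>
    sobolevNorm_add_le k p ω (hf.1 ε) (hg.1 ε)) ?_
  refine growth_const_mul_lt_top _ _ (ENNReal.LpAddConst_lt_top p).ne ?_
  exact growth_add_lt_top _ _ (hf.measurable_sobolevNorm k p ω)
    ((growth_anti q (le_max_left s t) _).trans_lt h₁)
    ((growth_anti q (le_max_right s t) _).trans_lt h₂)

lemma growth_sobolevNorm_smul {p q : ℝ≥0∞} {k : ℕ} {s : ℝ} {ω : Set (Space d)} {f : Net d}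
    (c : ℂ) (hf : IsSmoothNet f) (h : growth q s (fun ε => sobolevNorm k p ω (f ε)) < ∞) :
    growth q s (fun ε => sobolevNorm k p ω ((c • f) ε)) < ∞ :=
  lt_of_le_of_lt (growth_mono_fun _ _ fun ε => sobolevNorm_smul_le k p ω c (hf.1 ε))
    (growth_const_mul_lt_top _ _ enorm_ne_top h)

/-! ### The spaces of nets and of generalized functions -/

variable (d) in
/-- The space `𝓔_q(ℝ^d)` of nets of smooth functions with `L^q`-moderate growth. -/
def localModerate (p q : ℝ≥0∞) [hq : Fact (1 ≤ q)] : Submodule ℂ (Net d) where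
  carrier := {f | IsSmoothNet f ∧ ∀ (k : ℕ) (ω : Set (Space d)), IsOpen ω →
    IsCompact (closure ω) → ∃ s : ℝ, growth q s (fun ε => sobolevNorm k p ω (f ε)) < ∞}
  add_mem' := by
    rintro f g ⟨hf, hf'⟩ ⟨hg, hg'⟩
    refine ⟨hf.add hg, fun k ω ho hc => ?_⟩
    obtain ⟨s, hs⟩ := hf' k ω ho hc
    obtain ⟨t, ht⟩ := hg' k ω ho hc
    exact ⟨max s t, growth_sobolevNorm_add hf hg hs ht⟩
  zero_mem' := by
    refine ⟨isSmoothNet_zero, fun k ω _ _ => ⟨0, ?_⟩⟩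
    simp [sobolevNorm_zero, growth_zero hq.out]
  smul_mem' := by
    rintro c f ⟨hf, hf'⟩
    refine ⟨hf.smul c, fun k ω ho hc => ?_⟩
    obtain ⟨s, hs⟩ := hf' k ω ho hc
    exact ⟨s, growth_sobolevNorm_smul c hf hs⟩

variable (d) in
/-- The space `𝓔^{k,-s}_{q,L^p}(ℝ^d)`. -/
def globalBlock (p q : ℝ≥0∞) [hq : Fact (1 ≤ q)] (k : ℕ) (s : ℝ) : Submodule ℂ (Net d) where
  carrier := {f | f ∈ localModerate d p q ∧
    growth q s (fun ε => sobolevNorm k p univ (f ε)) < ∞}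
  add_mem' := by
    rintro f g ⟨hf, hf'⟩ ⟨hg, hg'⟩
    refine ⟨add_mem hf hg, ?_⟩
    simpa using growth_sobolevNorm_add hf.1 hg.1 hf' hg'
  zero_mem' := by
    refine ⟨zero_mem _, ?_⟩
    simp [sobolevNorm_zero, growth_zero hq.out]
  smul_mem' := by
    rintro c f ⟨hf, hf'⟩
    exact ⟨Submodule.smul_mem _ c hf, growth_sobolevNorm_smul c hf.1 hf'⟩

lemma globalBlock_mono (p q : ℝ≥0∞) [Fact (1 ≤ q)] (k : ℕ) {s t : ℝ} (h : s ≤ t) :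
    globalBlock d p q k s ≤ globalBlock d p q k t :=
  fun _ hf => ⟨hf.1, (growth_anti q h _).trans_lt hf.2⟩

variable (d) in
/-- The space of moderate nets `𝓔_{q,L^p}(ℝ^d) = ⋂_k ⋃_s 𝓔^{k,-s}_{q,L^p}(ℝ^d)`. -/
def moderate (p q : ℝ≥0∞) [hq : Fact (1 ≤ q)] : Submodule ℂ (Net d) where
  carrier := {f | ∀ k : ℕ, ∃ s : ℝ, f ∈ globalBlock d p q k s}
  add_mem' := by
    intro f g hf hg k
    obtain ⟨s, hs⟩ := hf k
    obtain ⟨t, ht⟩ := hg k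
    exact ⟨max s t, add_mem (globalBlock_mono p q k (le_max_left s t) hs)
      (globalBlock_mono p q k (le_max_right s t) ht)⟩
  zero_mem' := fun _ => ⟨0, zero_mem _⟩
  smul_mem' := by
    intro c f hf k
    obtain ⟨s, hs⟩ := hf k
    exact ⟨s, Submodule.smul_mem _ c hs⟩

variable (d) in
/-- The space of negligible nets `𝓝_{q,L^p}(ℝ^d) = ⋂_{k,s} 𝓔^{k,-s}_{q,L^p}(ℝ^d)`. -/
def negligible (p q : ℝ≥0∞) [hq : Fact (1 ≤ q)] : Submodule ℂ (Net d) :=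
  ⨅ (k : ℕ) (s : ℝ), globalBlock d p q k s

variable (d) in
/-- The negligible nets as a subspace of the moderate ones. -/
abbrev negligibleInModerate (p q : ℝ≥0∞) [hq : Fact (1 ≤ q)] : Submodule ℂ (moderate d p q) :=
  (negligible d p q).comap (moderate d p q).subtype

variable (d) in
/-- The space of generalized functions
`𝓖_{q,L^p}(ℝ^d) = 𝓔_{q,L^p}(ℝ^d) / 𝓝_{q,L^p}(ℝ^d)`. -/
abbrev GenFun (p q : ℝ≥0∞) [hq : Fact (1 ≤ q)] := moderate d p q ⧸ negligibleInModerate d p q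

/-! ### The distribution spaces -/

variable (d) in
/-- The space `W_0^{-k,p}(ℝ^d)`, the dual of `W_0^{k,p'}(ℝ^d)` (the closure of the test functions
in `W^{k,p'}(ℝ^d)`), where `1/p + 1/p' = 1`, as a space of tempered distributions: those
that are bounded on test functions for the norm of `W^{k,p'}(ℝ^d)`. -/
def negSobolev (k : ℕ) (p : ℝ≥0∞) : Submodule ℂ 𝓢'(Space d, ℂ) where
  carrier := {T | ∃ C : ℝ≥0, ∀ g : 𝓢(Space d, ℂ),
    ‖T g‖ₑ ≤ C * sobolevNorm k p.conjExponent univ g}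
  add_mem' := by
    rintro T S ⟨C, hC⟩ ⟨D, hD⟩
    refine ⟨C + D, fun g => ?_⟩
    refine (enorm_add_le (T g) (S g)).trans ?_
    rw [ENNReal.coe_add, add_mul]
    exact add_le_add (hC g) (hD g)
  zero_mem' := ⟨0, fun g => by simp⟩
  smul_mem' := by
    rintro c T ⟨C, hC⟩
    refine ⟨‖c‖₊ * C, fun g => ?_⟩
    have : ‖(c • T) g‖ₑ = ‖c‖ₑ * ‖T g‖ₑ := enorm_smul c (T g)
    rw [this, ENNReal.coe_mul, mul_assoc]
    exact mul_le_mul_right (hC g) _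

lemma negSobolev_mono {k l : ℕ} (h : k ≤ l) (p : ℝ≥0∞) : negSobolev d k p ≤ negSobolev d l p := by
  rintro T ⟨C, hC⟩
  exact ⟨C, fun g => (hC g).trans (by gcongr; exact sobolevNorm_mono h _ _ _)⟩

variable (d) in
/-- Schwartz' space `𝓓'_{L^p}(ℝ^d) = ⋃_k W_0^{-k,p}(ℝ^d)`. -/
def DPrimeLp (p : ℝ≥0∞) : Submodule ℂ 𝓢'(Space d, ℂ) where
  carrier := {T | ∃ k : ℕ, T ∈ negSobolev d k p}
  add_mem' := by
    rintro T S ⟨k, hk⟩ ⟨l, hl⟩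
    exact ⟨max k l, add_mem (negSobolev_mono (le_max_left k l) p hk)
      (negSobolev_mono (le_max_right k l) p hl)⟩
  zero_mem' := ⟨0, zero_mem _⟩
  smul_mem' := by
    rintro c T ⟨k, hk⟩
    exact ⟨k, Submodule.smul_mem _ c hk⟩

/-! ### Mollification -/

/-- A mollifier: a Schwartz function with integral one, all of whose higher moments vanish. -/
structure IsMollifier (φ : 𝓢(Space d, ℂ)) : Prop where
  integral_eq_one : ∫ x, φ x = 1
  moments : ∀ α : Fin d → ℕ, α ≠ 0 → ∫ x : Space d, ((∏ i, x i ^ α i : ℝ) : ℂ) * φ x = 0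

/-- The delta net `φ_ε = ε^{-d} φ(·/ε)`. -/
def deltaNet (φ : 𝓢(Space d, ℂ)) (ε : Ioo (0 : ℝ) 1) : 𝓢(Space d, ℂ) :=
  (((ε : ℝ) ^ d)⁻¹ : ℝ) • SchwartzMap.compCLMOfContinuousLinearEquiv ℂ
    (ContinuousLinearEquiv.smulLeft (Units.mk0 (ε : ℝ) ε.2.1.ne')⁻¹) φ

lemma deltaNet_apply (φ : 𝓢(Space d, ℂ)) (ε : Ioo (0 : ℝ) 1) (x : Space d) :
    deltaNet φ ε x = (((ε : ℝ) ^ d)⁻¹ : ℝ) • φ ((ε : ℝ)⁻¹ • x) := rfl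

/-- For a Schwartz function `ψ`, the Schwartz function `y ↦ ψ (x - y)`. -/
def reflectAt (ψ : 𝓢(Space d, ℂ)) (x : Space d) : 𝓢(Space d, ℂ) :=
  SchwartzMap.compSubConstCLM ℂ x
    (SchwartzMap.compCLMOfContinuousLinearEquiv ℂ (ContinuousLinearEquiv.neg ℝ) ψ)

lemma reflectAt_apply (ψ : 𝓢(Space d, ℂ)) (x y : Space d) : reflectAt ψ x y = ψ (x - y) := by
  change ψ (-(y - x)) = ψ (x - y)
  rw [neg_sub]

/-- The net `(T * φ_ε)_ε`, where `(T * φ_ε)(x) = ⟨T, φ_ε(x - ·)⟩`, as a linear map of `T`. -/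
def mollify (φ : 𝓢(Space d, ℂ)) : 𝓢'(Space d, ℂ) →ₗ[ℂ] Net d where
  toFun T := fun ε x => T (reflectAt (deltaNet φ ε) x)
  map_add' _ _ := rfl
  map_smul' _ _ := rfl

/-- The map `T ↦ [(T * φ_ε)_ε]` from a subspace `V` of `𝓢'` to `𝓖_{q,L^p}`, given that all
the nets `(T * φ_ε)_ε` with `T ∈ V` are moderate. -/
def mollifyClass (φ : 𝓢(Space d, ℂ)) (p q : ℝ≥0∞) [hq : Fact (1 ≤ q)]
    (V : Submodule ℂ 𝓢'(Space d, ℂ)) (hV : ∀ T ∈ V, mollify φ T ∈ moderate d p q) :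
    V →ₗ[ℂ] GenFun d p q :=
  (negligibleInModerate d p q).mkQ ∘ₗ (mollify φ).restrict hV

/-- The subspace `V` of `𝓢'` embeds into `𝓖_{q,L^p}` by mollification: `T ↦ [(T * φ_ε)_ε]` is
a well defined and injective linear map on `V`. -/
def EmbedsByMollification (φ : 𝓢(Space d, ℂ)) (p q : ℝ≥0∞) [hq : Fact (1 ≤ q)]
    (V : Submodule ℂ 𝓢'(Space d, ℂ)) : Prop :=
  ∃ hV : ∀ T ∈ V, mollify φ T ∈ moderate d p q,
    Function.Injective (mollifyClass φ p q V hV)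

end QColombeau

end

/-!
The proof uses only `∫ φ = 1`; the higher moments of the mollifier play no role.

Smoothing of test functions is dual to mollification. With the correlation
`A_ε g (y) = ∫ φ_ε(z) g(y + z) dz` one has `⟨T, A_ε g⟩ = ∫ g (T * φ_ε)` (`dist_correlation'`), so
`|⟨T, A_ε g⟩| ≤ ‖T * φ_ε‖_p ‖g‖_{p'}` by Hölder's inequality
(`norm_dist_correlation_deltaNet_le`).

*Moderate mollifications imply `T ∈ 𝓓'_{L^p}`* (`mem_DPrimeLp_of_mollify_mem_moderate`). Finiteness
of the growth integral yields a scale `ε_j ∈ (2^{-j-1}, 2^{-j})` with `‖T * φ_{ε_j}‖_p ≤ C ε_j^{-σ}`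
for every `j` (`exists_dyadic_scale`). Let `r_n = ∏_{j < n} (1 - A_{ε_j}) g`. Since
`r_n - r_{n+1} = A_{ε_n} r_n`, telescoping gives `⟨T, g⟩ = ⟨T, r_n⟩ + ∑_{j < n} ⟨T, A_{ε_j} r_j⟩`.
The operators `A_ε` commute with derivatives and are bounded uniformly in `ε`, and `1 - A_ε` gains a
factor `ε` at the cost of one derivative, because `∫ φ = 1`. Using this gain in the last `m` factors
of `r_n` shows that `‖r_n‖ ≤ C_m (B 2^{-m})^n ‖g‖_{W^m}` with `B` independent of `m`
(`IsTame.exists_residual_le`). In the norm of `L^{p'}`, with `2^m ≥ 2 ⬝ 2^σ B`, the series is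
dominated by a geometric one, and its sum by a multiple of `‖g‖_{W^{m,p'}}`. The remainder
`⟨T, r_n⟩` tends to zero by the same estimate for the norm
`N_T(g) = sup_x |⟨T, g(· + x)⟩| / (1 + |x|)^K`, which is finite as `T` is tempered
(`exists_isTame_dist`); its order `m` does not enter the final bound. Both norms are covered by the
notion `IsTame`.

*Elements of `𝓓'_{L^p}` have moderate mollifications* (`mollify_mem_moderate`). If
`T ∈ W_0^{-k,p}`, then `|∫ g (T * ψ)| = |⟨T, A g⟩| ≤ C ‖ψ‖_{W^{k,1}} ‖g‖_{p'}` for the correlation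
`A` with `ψ`, as all derivatives can be moved to `ψ`. The converse of Hölder's inequality
(`eLpNorm_le_of_forall_integral_le`) bounds `‖T * ψ‖_p`, and `‖φ_ε‖_{W^{k,1}} = O(ε^{-k})`.

*Injectivity* (`eq_zero_of_mollify_mem_negligible`). If the mollifications are negligible, then
`⟨T, A_{ε_j} g⟩ → 0` along suitable scales `ε_j → 0`, while `⟨T, A_{ε_j} g⟩ → ⟨T, g⟩`.

The exchange of tempered distributions with integrals over Schwartz functions, which all of this
needs, is `exists_schwartz_integral`: a tempered distribution factors through finitely many weighted
jets in Banach spaces of bounded continuous functions, where Bochner integrals are available.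
-/

noncomputable section

namespace QColombeau

open Filter Topology
open scoped LineDeriv BoundedContinuousFunction

variable {d : ℕ}

/-! ### Integrals of Schwartz-valued maps -/

variable (d) in
/-- The Banach space of bounded continuous functions with values in the `n`-linear forms. -/
def Jet (n : ℕ) : Type := Space d →ᵇ ((Space d) [×n]→L[ℝ] ℂ)

instance (n : ℕ) : NormedAddCommGroup (Jet d n) :=
  inferInstanceAs (NormedAddCommGroup (Space d →ᵇ ((Space d) [×n]→L[ℝ] ℂ)))

instance (n : ℕ) : NormedSpace ℂ (Jet d n) :=
  inferInstanceAs (NormedSpace ℂ (Space d →ᵇ ((Space d) [×n]→L[ℝ] ℂ)))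

instance (n : ℕ) : CompleteSpace (Jet d n) :=
  inferInstanceAs (CompleteSpace (Space d →ᵇ ((Space d) [×n]→L[ℝ] ℂ)))

/-- Evaluation of jets at a point. -/
def jetEval (n : ℕ) (y : Space d) : Jet d n →L[ℂ] ((Space d) [×n]→L[ℝ] ℂ) :=
  BoundedContinuousFunction.evalCLM (β := (Space d) [×n]→L[ℝ] ℂ) ℂ y

lemma jet_norm_le {n : ℕ} {f : Jet d n} {C : ℝ} (hC : 0 ≤ C) :
    ‖f‖ ≤ C ↔ ∀ y, ‖jetEval n y f‖ ≤ C :=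
  BoundedContinuousFunction.norm_le (β := (Space d) [×n]→L[ℝ] ℂ) hC

lemma jet_ext {n : ℕ} {f g : Jet d n} (h : ∀ y, jetEval n y f = jetEval n y g) : f = g :=
  BoundedContinuousFunction.ext (β := (Space d) [×n]→L[ℝ] ℂ) h

/-- The map `g ↦ ‖·‖^k D^n g` from Schwartz functions to bounded continuous functions, whose norm
is the Schwartz seminorm with indices `(k, n)`. -/
def weightedJet (k n : ℕ) : 𝓢(Space d, ℂ) →L[ℂ] Jet d n :=
  SchwartzMap.mkCLMtoNormedSpace
    (fun g => BoundedContinuousFunction.ofNormedAddCommGroup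
      (fun y => (‖y‖ ^ k : ℝ) • iteratedFDeriv ℝ n g y)
      ((continuous_norm.pow k).smul ((g.smooth n).continuous_iteratedFDeriv le_rfl))
      (SchwartzMap.seminorm ℂ k n g) (fun y => by
        rw [norm_smul, norm_pow, norm_norm]; exact g.le_seminorm ℂ k n y))
    (fun f g => by
      refine jet_ext fun y => ?_
      change (‖y‖ ^ k : ℝ) • iteratedFDeriv ℝ n (f + g : 𝓢(Space d, ℂ)) y
        = (‖y‖ ^ k : ℝ) • iteratedFDeriv ℝ n f y + (‖y‖ ^ k : ℝ) • iteratedFDeriv ℝ n g y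
      rw [← smul_add, ← iteratedFDeriv_add_apply (f.smooth n).contDiffAt (g.smooth n).contDiffAt]
      rfl)
    (fun c f => by
      refine jet_ext fun y => ?_
      change (‖y‖ ^ k : ℝ) • iteratedFDeriv ℝ n (c • f : 𝓢(Space d, ℂ)) y
        = c • (‖y‖ ^ k : ℝ) • iteratedFDeriv ℝ n f y
      rw [smul_comm, ← iteratedFDeriv_const_smul_apply (f.smooth n).contDiffAt]
      rfl)
    ⟨{(k, n)}, 1, zero_le_one, fun g => by
      rw [Finset.sup_singleton, one_mul]
      refine (jet_norm_le (apply_nonneg _ _)).2 fun y => ?_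
      change ‖(‖y‖ ^ k : ℝ) • iteratedFDeriv ℝ n g y‖ ≤ _
      rw [norm_smul, norm_pow, norm_norm]
      exact g.le_seminorm ℂ k n y⟩

lemma weightedJet_apply (k n : ℕ) (g : 𝓢(Space d, ℂ)) (y : Space d) :
    jetEval n y (weightedJet k n g) = (‖y‖ ^ k : ℝ) • iteratedFDeriv ℝ n g y := rfl

lemma norm_weightedJet (k n : ℕ) (g : 𝓢(Space d, ℂ)) :
    ‖weightedJet k n g‖ = SchwartzMap.seminorm ℂ k n g := by
  apply le_antisymm
  · refine (jet_norm_le (apply_nonneg _ _)).2 fun y => ?_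
    rw [weightedJet_apply, norm_smul, norm_pow, norm_norm]
    exact g.le_seminorm ℂ k n y
  · refine g.seminorm_le_bound ℂ k n (norm_nonneg _) fun y => ?_
    have := (jet_norm_le (norm_nonneg (weightedJet k n g))).1 le_rfl y
    rwa [weightedJet_apply, norm_smul, norm_pow, norm_norm] at this

/-- A tempered distribution factors through finitely many weighted jets: it is bounded by finitely
many seminorms, hence induces a bounded functional on the range of the weighted jets, which extends
by the Hahn-Banach theorem. -/
lemma exists_factor_weightedJet (T : 𝓢'(Space d, ℂ)) :
    ∃ (s : Finset (ℕ × ℕ)) (l : StrongDual ℂ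
        (∀ i : s, Jet d i.1.2)),
      ∀ g, T g = l (fun i => weightedJet i.1.1 i.1.2 g) := by
  have hc : Continuous ((normSeminorm ℂ ℂ).comp (T : 𝓢(Space d, ℂ) →ₗ[ℂ] ℂ)) :=
    continuous_norm.comp (map_continuous T)
  obtain ⟨s, C, -, hC⟩ := Seminorm.bound_of_continuous
    (schwartz_withSeminorms ℂ (Space d) ℂ) _ hc
  let J : 𝓢(Space d, ℂ) →ₗ[ℂ] (∀ i : s, Jet d i.1.2) :=
    LinearMap.pi fun i => (weightedJet i.1.1 i.1.2).toLinearMap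
  have hJ : ∀ g, ‖T g‖ ≤ C * ‖J g‖ := by
    intro g
    refine (hC g).trans ?_
    rw [smul_apply, NNReal.smul_def, smul_eq_mul]
    gcongr
    refine Seminorm.finset_sup_apply_le (norm_nonneg _) fun i hi => ?_
    rw [schwartzSeminormFamily, ← norm_weightedJet]
    exact norm_le_pi_norm (J g) ⟨i, hi⟩
  have hker : LinearMap.ker J ≤ LinearMap.ker (T : 𝓢(Space d, ℂ) →ₗ[ℂ] ℂ) := by
    intro g hg
    have h0 : J g = 0 := hg
    have := hJ g
    rw [h0, norm_zero, mul_zero] at this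
    exact norm_le_zero_iff.1 this
  have hmem : (T : 𝓢(Space d, ℂ) →ₗ[ℂ] ℂ) ∈ LinearMap.range J.dualMap := by
    rw [LinearMap.range_dualMap_eq_dualAnnihilator_ker, Submodule.mem_dualAnnihilator]
    exact fun g hg => hker hg
  obtain ⟨l₀, hl₀⟩ := hmem
  have hl₀' : ∀ g, l₀ (J g) = T g := fun g => LinearMap.congr_fun hl₀ g
  let l₁ : StrongDual ℂ (LinearMap.range J) :=
    (l₀.domRestrict (LinearMap.range J)).mkContinuous C (by
      rintro ⟨_, g, rfl⟩
      change ‖l₀ (J g)‖ ≤ C * ‖J g‖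
      rw [hl₀']
      exact hJ g)
  obtain ⟨l, hl, -⟩ := exists_extension_norm_eq (LinearMap.range J) l₁
  refine ⟨s, l, fun g => ?_⟩
  rw [← hl₀']
  exact (hl ⟨J g, g, rfl⟩).symm

section

variable {X : Type*} [MeasurableSpace X] [TopologicalSpace X] [OpensMeasurableSpace X]
  [SecondCountableTopology X]

lemma integrable_weightedJet {μ : Measure X} {Φ : X → 𝓢(Space d, ℂ)} (hΦ : Continuous Φ)
    {k n : ℕ} (hint : Integrable (fun x => SchwartzMap.seminorm ℂ k n (Φ x)) μ) :
    Integrable (fun x => weightedJet k n (Φ x)) μ := by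
  refine hint.mono' ((weightedJet k n).continuous.comp hΦ).aestronglyMeasurable ?_
  exact .of_forall fun x => (norm_weightedJet k n (Φ x)).le

lemma integrable_iteratedFDeriv {μ : Measure X} {Φ : X → 𝓢(Space d, ℂ)} (hΦ : Continuous Φ)
    (hint : ∀ k n, Integrable (fun x => SchwartzMap.seminorm ℂ k n (Φ x)) μ) (n : ℕ)
    (y : Space d) : Integrable (fun x => iteratedFDeriv ℝ n (Φ x) y) μ := by
  have := (jetEval n y).integrable_comp
    (integrable_weightedJet hΦ (hint 0 n))
  simpa [weightedJet_apply] using this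

/-- Differentiation under the integral sign, to all orders. -/
lemma iteratedFDeriv_integral_schwartz {μ : Measure X} {Φ : X → 𝓢(Space d, ℂ)}
    (hΦ : Continuous Φ)
    (hint : ∀ k n, Integrable (fun x => SchwartzMap.seminorm ℂ k n (Φ x)) μ) (n : ℕ) :
    ContDiff ℝ n (fun y => ∫ x, Φ x y ∂μ) ∧
      ∀ y, iteratedFDeriv ℝ n (fun y => ∫ x, Φ x y ∂μ) y
        = ∫ x, iteratedFDeriv ℝ n (Φ x) y ∂μ := by
  have key : ∀ n y, HasFDerivAt (fun y => ∫ x, iteratedFDeriv ℝ n (Φ x) y ∂μ)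
      (∫ x, fderiv ℝ (iteratedFDeriv ℝ n (Φ x)) y ∂μ) y := by
    intro n y
    have hlin : ∀ x y, fderiv ℝ (iteratedFDeriv ℝ n (Φ x)) y
        = (continuousMultilinearCurryLeftEquiv ℝ (fun _ : Fin (n + 1) => Space d) ℂ)
          (iteratedFDeriv ℝ (n + 1) (Φ x) y) := fun x y => by
      rw [iteratedFDeriv_succ_eq_comp_left]; simp
    refine hasFDerivAt_integral_of_dominated_of_fderiv_le (𝕜 := ℝ) (H := Space d)
      (E := (Space d) [×n]→L[ℝ] ℂ) (s := univ)
      (F := fun y x => iteratedFDeriv ℝ n (Φ x) y)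
      (F' := fun y x => fderiv ℝ (iteratedFDeriv ℝ n (Φ x)) y)
      (bound := fun x => SchwartzMap.seminorm ℂ 0 (n + 1) (Φ x)) univ_mem
      (.of_forall fun y => (integrable_iteratedFDeriv hΦ hint n y).aestronglyMeasurable)
      (integrable_iteratedFDeriv hΦ hint n y) ?_ ?_ (hint 0 (n + 1)) ?_
    · simp only [hlin]
      exact (LinearIsometryEquiv.continuous (continuousMultilinearCurryLeftEquiv ℝ
        (fun _ : Fin (n + 1) => Space d) ℂ)).comp_aestronglyMeasurable
        (integrable_iteratedFDeriv hΦ hint (n + 1) y).aestronglyMeasurable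
    · refine .of_forall fun x z _ => ?_
      rw [norm_fderiv_iteratedFDeriv]
      exact (Φ x).norm_iteratedFDeriv_le_seminorm ℂ (n + 1) z
    · refine .of_forall fun x z _ => ?_
      exact (((Φ x).smooth ⊤).differentiable_iteratedFDeriv
        (mod_cast ENat.natCast_lt_top n) z).hasFDerivAt
  have hfd : ∀ n, (∀ y, iteratedFDeriv ℝ n (fun y => ∫ x, Φ x y ∂μ) y
        = ∫ x, iteratedFDeriv ℝ n (Φ x) y ∂μ) := by
    intro n
    induction n with
    | zero =>
      intro y
      simp only [iteratedFDeriv_zero_eq_comp, Function.comp_apply]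
      exact ((continuousMultilinearCurryFin0 ℝ (Space d)
        ℂ).symm.toContinuousLinearEquiv.integral_comp_comm _).symm
    | succ n ih =>
      intro y
      have ih' : iteratedFDeriv ℝ n (fun y => ∫ x, Φ x y ∂μ)
          = fun y => ∫ x, iteratedFDeriv ℝ n (Φ x) y ∂μ := funext ih
      simp only [iteratedFDeriv_succ_eq_comp_left, Function.comp_apply]
      rw [ih', (key n y).fderiv]
      have h := ContinuousLinearEquiv.integral_comp_comm (𝕜 := ℝ) (μ := μ)
        (E := Space d →L[ℝ] ((Space d) [×n]→L[ℝ] ℂ)) (F := (Space d) [×(n + 1)]→L[ℝ] ℂ)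
        (continuousMultilinearCurryLeftEquiv ℝ (fun _ : Fin (n + 1) => Space d)
          ℂ).symm.toContinuousLinearEquiv (fun x => fderiv ℝ (iteratedFDeriv ℝ n (Φ x)) y)
      exact h.symm
  refine ⟨?_, hfd n⟩
  refine contDiff_of_differentiable_iteratedFDeriv fun m _ => ?_
  rw [funext (hfd m)]
  exact fun y => (key m y).differentiableAt

/-- A continuous Schwartz-valued map with integrable seminorms has an integral in the Schwartz
space, and this integral commutes with all tempered distributions. -/
theorem exists_schwartz_integral {μ : Measure X} {Φ : X → 𝓢(Space d, ℂ)} (hΦ : Continuous Φ)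
    (hint : ∀ k n, Integrable (fun x => SchwartzMap.seminorm ℂ k n (Φ x)) μ) :
    ∃ G : 𝓢(Space d, ℂ), (∀ y, G y = ∫ x, Φ x y ∂μ) ∧
      ∀ T : 𝓢'(Space d, ℂ), Integrable (fun x => T (Φ x)) μ ∧ T G = ∫ x, T (Φ x) ∂μ := by
  have hD := iteratedFDeriv_integral_schwartz hΦ hint
  let G : 𝓢(Space d, ℂ) :=
    { toFun := fun y => ∫ x, Φ x y ∂μ
      smooth' := contDiff_infty.2 fun n => (hD n).1
      decay' := fun k n => ⟨∫ x, SchwartzMap.seminorm ℂ k n (Φ x) ∂μ, fun y => by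
        rw [(hD n).2, ← norm_norm y, ← norm_pow, ← norm_smul, ← integral_smul]
        refine norm_integral_le_of_norm_le (hint k n) (.of_forall fun x => ?_)
        rw [norm_smul, norm_pow, norm_norm]
        exact (Φ x).le_seminorm ℂ k n y⟩ }
  refine ⟨G, fun _ => rfl, fun T => ?_⟩
  obtain ⟨s, l, hl⟩ := exists_factor_weightedJet T
  have hi : ∀ i : s, Integrable (fun x => weightedJet i.1.1 i.1.2 (Φ x)) μ :=
    fun i => integrable_weightedJet hΦ (hint _ _)
  have hpi := Integrable.of_eval (f := fun x => fun i : s => weightedJet i.1.1 i.1.2 (Φ x)) hi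
  simp only [hl]
  refine ⟨l.integrable_comp hpi, ?_⟩
  rw [l.integral_comp_comm hpi]
  congr 1
  ext1 i
  rw [eval_integral hi]
  refine jet_ext fun y => ?_
  have := (jetEval i.1.2 y).integral_comp_comm (hi i)
  rw [← this]
  simp only [weightedJet_apply]
  rw [integral_smul]
  congr 1
  exact (hD _).2 y

end

/-! ### Affine changes of variables and translations -/

lemma iteratedFDeriv_affine (ψ : 𝓢(Space d, ℂ)) (a : ℝ) (b : Space d) (n : ℕ) (y : Space d) :
    iteratedFDeriv ℝ n (fun y => ψ (a • y + b)) y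
      = a ^ n • iteratedFDeriv ℝ n ψ (a • y + b) := by
  have hs : ContDiff ℝ n (fun y => ψ (y + b)) := (ψ.smooth n).comp (by fun_prop)
  rw [show (fun y => ψ (a • y + b)) = fun y => (fun y => ψ (y + b)) (a • y) from rfl,
    iteratedFDeriv_comp_const_smul a hs]
  simp only [iteratedFDeriv_comp_add_right]

/-- A weighted `C^n`-norm of a Schwartz function, bounding the seminorms of its affine
pullbacks. -/
def affineBound (k n : ℕ) (ψ : 𝓢(Space d, ℂ)) : ℝ :=
  2 ^ k * (Finset.Iic (k, n)).sup (schwartzSeminormFamily ℂ (Space d) ℂ) ψ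

lemma affineBound_nonneg (k n : ℕ) (ψ : 𝓢(Space d, ℂ)) : 0 ≤ affineBound k n ψ :=
  mul_nonneg (by positivity) (apply_nonneg _ _)

lemma seminorm_affine_le {ψ Φ : 𝓢(Space d, ℂ)} {a : ℝ} (ha : a ≠ 0) {b : Space d}
    (h : ∀ y, Φ y = ψ (a • y + b)) (k n : ℕ) :
    SchwartzMap.seminorm ℂ k n Φ ≤ |a| ^ n * |a|⁻¹ ^ k * (1 + ‖b‖) ^ k * affineBound k n ψ := by
  have h0 := affineBound_nonneg k n ψ
  refine Φ.seminorm_le_bound ℂ k n (by positivity) fun y => ?_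
  rw [show (Φ : Space d → ℂ) = fun y => ψ (a • y + b) from funext h, iteratedFDeriv_affine,
    norm_smul, norm_pow, Real.norm_eq_abs]
  have h1 : (1 + ‖a • y + b‖) ^ k * ‖iteratedFDeriv ℝ n ψ (a • y + b)‖ ≤ affineBound k n ψ :=
    SchwartzMap.one_add_le_sup_seminorm_apply (m := (k, n)) le_rfl le_rfl ψ (a • y + b)
  have hapos : 0 < |a| := abs_pos.2 ha
  have h2 : ‖y‖ ≤ |a|⁻¹ * ((1 + ‖b‖) * (1 + ‖a • y + b‖)) := by
    rw [inv_mul_eq_div, le_div_iff₀ hapos, mul_comm, ← Real.norm_eq_abs, ← norm_smul]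
    calc ‖a • y‖ = ‖(a • y + b) - b‖ := by rw [add_sub_cancel_right]
      _ ≤ ‖a • y + b‖ + ‖b‖ := norm_sub_le _ _
      _ ≤ (1 + ‖b‖) * (1 + ‖a • y + b‖) := by
        nlinarith [norm_nonneg b, norm_nonneg (a • y + b),
          mul_nonneg (norm_nonneg b) (norm_nonneg (a • y + b))]
  calc ‖y‖ ^ k * (|a| ^ n * ‖iteratedFDeriv ℝ n ψ (a • y + b)‖)
      ≤ (|a|⁻¹ * ((1 + ‖b‖) * (1 + ‖a • y + b‖))) ^ k
        * (|a| ^ n * ‖iteratedFDeriv ℝ n ψ (a • y + b)‖) := by gcongr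
    _ = |a| ^ n * |a|⁻¹ ^ k * (1 + ‖b‖) ^ k
        * ((1 + ‖a • y + b‖) ^ k * ‖iteratedFDeriv ℝ n ψ (a • y + b)‖) := by
        rw [mul_pow, mul_pow]; ring
    _ ≤ _ := by gcongr

/-- A map into the Schwartz space is continuous as soon as its seminorms are locally bounded and
its derivatives are jointly continuous: the decay of higher order makes the tails small, and
compactness handles the rest. -/
lemma continuous_of_locally_bounded_seminorm {X : Type*} [TopologicalSpace X]
    {Φ : X → 𝓢(Space d, ℂ)}
    (hb : ∀ x₀ k n, ∃ C, ∀ᶠ x in 𝓝 x₀, SchwartzMap.seminorm ℂ k n (Φ x) ≤ C)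
    (hc : ∀ n, Continuous fun z : X × Space d => iteratedFDeriv ℝ n (Φ z.1) z.2) :
    Continuous Φ := by
  refine continuous_iff_continuousAt.2 fun x₀ => ?_
  refine ((schwartz_withSeminorms ℂ (Space d) ℂ).tendsto_nhds Φ (Φ x₀)).2 ?_
  rintro ⟨k, n⟩ ε hε
  obtain ⟨C, hC⟩ := hb x₀ (k + 1) n
  have hC₀ : SchwartzMap.seminorm ℂ (k + 1) n (Φ x₀) ≤ C := hC.self_of_nhds
  have hCnn : 0 ≤ C := (apply_nonneg _ _).trans hC₀
  -- outside the ball of radius `R` the seminorms of order `k + 1` make the difference small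
  set R : ℝ := (4 * C + 1) / ε with hR
  have hRpos : 0 < R := by positivity
  have hcont : Continuous fun z : X × Space d =>
      ‖z.2‖ ^ k * ‖iteratedFDeriv ℝ n (Φ z.1) z.2 - iteratedFDeriv ℝ n (Φ x₀) z.2‖ := by
    have h2 : Continuous fun z : X × Space d => iteratedFDeriv ℝ n (Φ x₀) z.2 :=
      (hc n).comp ((continuous_const (y := x₀)).prodMk continuous_snd)
    exact (continuous_snd.norm.pow k).mul ((hc n).sub h2).norm
  have hK := (isCompact_closedBall (0 : Space d) R).eventually_forall_of_forall_eventually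
    (x₀ := x₀) (P := fun x y =>
      ‖y‖ ^ k * ‖iteratedFDeriv ℝ n (Φ x) y - iteratedFDeriv ℝ n (Φ x₀) y‖ < ε / 2)
    (fun y _ => by
      refine hcont.continuousAt.eventually_lt (f := fun z : X × Space d =>
        ‖z.2‖ ^ k * ‖iteratedFDeriv ℝ n (Φ z.1) z.2 - iteratedFDeriv ℝ n (Φ x₀) z.2‖)
        (g := fun _ => ε / 2) (x₀ := (x₀, y)) continuousAt_const ?_
      simpa using hε)
  filter_upwards [hC, hK] with x hx hxK
  change SchwartzMap.seminorm ℂ k n (Φ x - Φ x₀) < ε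
  refine lt_of_le_of_lt ((Φ x - Φ x₀).seminorm_le_bound ℂ k n (half_pos hε).le fun y => ?_)
    (half_lt_self hε)
  have hsub : iteratedFDeriv ℝ n (Φ x - Φ x₀ : 𝓢(Space d, ℂ)) y
      = iteratedFDeriv ℝ n (Φ x) y - iteratedFDeriv ℝ n (Φ x₀) y :=
    iteratedFDeriv_sub_apply ((Φ x).smooth n).contDiffAt ((Φ x₀).smooth n).contDiffAt
  rw [hsub]
  by_cases hy : ‖y‖ ≤ R
  · exact (hxK y (by simpa using hy)).le
  · have hy' : R < ‖y‖ := not_le.1 hy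
    have h1 := (Φ x).le_seminorm ℂ (k + 1) n y
    have h2 := (Φ x₀).le_seminorm ℂ (k + 1) n y
    have h3 : ‖y‖ * (‖y‖ ^ k * ‖iteratedFDeriv ℝ n (Φ x) y - iteratedFDeriv ℝ n (Φ x₀) y‖)
        ≤ 2 * C := by
      calc _ ≤ ‖y‖ * (‖y‖ ^ k * (‖iteratedFDeriv ℝ n (Φ x) y‖
              + ‖iteratedFDeriv ℝ n (Φ x₀) y‖)) := by gcongr; exact norm_sub_le _ _
        _ = ‖y‖ ^ (k + 1) * ‖iteratedFDeriv ℝ n (Φ x) y‖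
            + ‖y‖ ^ (k + 1) * ‖iteratedFDeriv ℝ n (Φ x₀) y‖ := by ring
        _ ≤ 2 * C := by linarith
    set u := ‖y‖ ^ k * ‖iteratedFDeriv ℝ n (Φ x) y - iteratedFDeriv ℝ n (Φ x₀) y‖ with hu
    have hu0 : 0 ≤ u := by positivity
    have h4 : R * u ≤ 2 * C := (mul_le_mul_of_nonneg_right hy'.le hu0).trans h3
    have h5 : (4 * C + 1) * u ≤ 2 * C * ε := by
      have : R * ε = 4 * C + 1 := by rw [hR]; field_simp
      nlinarith
    by_contra hcon
    nlinarith [not_le.1 hcon]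

lemma continuous_affine {X : Type*} [TopologicalSpace X] {Φ : X → 𝓢(Space d, ℂ)}
    {ψ : 𝓢(Space d, ℂ)} {a : X → ℝ} {b : X → Space d} (ha : Continuous a) (hb : Continuous b)
    (ha0 : ∀ x, a x ≠ 0) (h : ∀ x y, Φ x y = ψ (a x • y + b x)) : Continuous Φ := by
  refine continuous_of_locally_bounded_seminorm (fun x₀ k n => ?_) fun n => ?_
  · have hcont : Continuous fun x =>
        |a x| ^ n * |a x|⁻¹ ^ k * (1 + ‖b x‖) ^ k * affineBound k n ψ := by
      have : Continuous fun x => |a x|⁻¹ := ha.abs.inv₀ fun x => abs_ne_zero.2 (ha0 x)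
      fun_prop
    refine ⟨|a x₀| ^ n * |a x₀|⁻¹ ^ k * (1 + ‖b x₀‖) ^ k * affineBound k n ψ + 1, ?_⟩
    filter_upwards [(hcont.tendsto x₀).eventually (eventually_le_nhds (lt_add_one _))] with x hx
    exact (seminorm_affine_le (ha0 x) (h x) k n).trans hx
  · have heq : (fun z : X × Space d => iteratedFDeriv ℝ n (Φ z.1) z.2)
        = fun z => a z.1 ^ n • iteratedFDeriv ℝ n ψ (a z.1 • z.2 + b z.1) := by
      funext z
      rw [show (Φ z.1 : Space d → ℂ) = fun y => ψ (a z.1 • y + b z.1) from funext (h z.1),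
        iteratedFDeriv_affine]
    rw [heq]
    have h1 : Continuous (iteratedFDeriv ℝ n ψ) := (ψ.smooth n).continuous_iteratedFDeriv le_rfl
    exact ((ha.comp continuous_fst).pow n).smul (h1.comp (by fun_prop))

/-- The translate `y ↦ g (y + z)`. -/
def translate (z : Space d) (g : 𝓢(Space d, ℂ)) : 𝓢(Space d, ℂ) :=
  SchwartzMap.compSubConstCLM ℂ (-z) g

lemma translate_apply (z : Space d) (g : 𝓢(Space d, ℂ)) (y : Space d) :
    translate z g y = g (y + z) := by
  simp [translate]

lemma translate_zero (g : 𝓢(Space d, ℂ)) : translate 0 g = g := by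
  ext y; simp [translate_apply]

lemma translate_translate (z w : Space d) (g : 𝓢(Space d, ℂ)) :
    translate z (translate w g) = translate (z + w) g := by
  ext y; simp [translate_apply, add_assoc]

lemma continuous_translate (g : 𝓢(Space d, ℂ)) : Continuous fun z => translate z g :=
  continuous_affine (a := fun _ => 1) (b := id) (ψ := g) continuous_const continuous_id
    (fun _ => one_ne_zero) fun z y => by simp [translate_apply]

lemma seminorm_translate_le (k n : ℕ) (z : Space d) (g : 𝓢(Space d, ℂ)) :
    SchwartzMap.seminorm ℂ k n (translate z g) ≤ (1 + ‖z‖) ^ k * affineBound k n g := by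
  simpa using seminorm_affine_le (ψ := g) (a := 1) one_ne_zero (b := z)
    (fun y => by simp [translate_apply]) k n

lemma continuous_reflectAt (ψ : 𝓢(Space d, ℂ)) : Continuous fun x => reflectAt ψ x :=
  continuous_affine (a := fun _ => -1) (b := id) (ψ := ψ) continuous_const continuous_id
    (fun _ => by norm_num) fun z y => by
      simp only [reflectAt_apply, id]; congr 1; simp [sub_eq_neg_add]

lemma seminorm_reflectAt_le (k n : ℕ) (x : Space d) (ψ : 𝓢(Space d, ℂ)) :
    SchwartzMap.seminorm ℂ k n (reflectAt ψ x) ≤ (1 + ‖x‖) ^ k * affineBound k n ψ := by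
  simpa using seminorm_affine_le (ψ := ψ) (a := -1) (by norm_num) (b := x)
    (fun y => by simp only [reflectAt_apply]; congr 1; simp [sub_eq_neg_add]) k n

/-- The `i`-th coordinate direction. -/
abbrev dir (i : Fin d) : Space d := EuclideanSpace.single i (1 : ℝ)

lemma sum_smul_dir (v : Space d) : ∑ i, v i • dir i = v := by
  ext j
  simp [Finset.sum_apply, Pi.single_apply]

lemma lineDeriv_eq_sum (v : Space d) (g : 𝓢(Space d, ℂ)) :
    ∂_{v} g = ∑ i, v i • ∂_{dir i} g := by
  ext y
  rw [sum_apply]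
  simp only [smul_apply, SchwartzMap.lineDerivOp_apply_eq_fderiv]
  conv_lhs => rw [← sum_smul_dir v]
  rw [map_sum]
  simp only [map_smul]

lemma lineDeriv_translate (z v : Space d) (g : 𝓢(Space d, ℂ)) :
    ∂_{v} (translate z g) = translate z (∂_{v} g) := by
  ext y
  rw [translate_apply, SchwartzMap.lineDerivOp_apply_eq_fderiv,
    SchwartzMap.lineDerivOp_apply_eq_fderiv,
    show (translate z g : Space d → ℂ) = fun y => g (y + z) from funext (translate_apply z g),
    fderiv_comp_add_right]

lemma lineDeriv_reflectAt (x v : Space d) (ψ : 𝓢(Space d, ℂ)) :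
    ∂_{v} (reflectAt ψ x) = - reflectAt (∂_{v} ψ) x := by
  ext y
  rw [neg_apply, reflectAt_apply, SchwartzMap.lineDerivOp_apply_eq_fderiv,
    SchwartzMap.lineDerivOp_apply_eq_fderiv,
    show (reflectAt ψ x : Space d → ℂ) = fun y => ψ (x - y) from funext (reflectAt_apply ψ x)]
  have h := (ψ.hasFDerivAt (x - y)).comp y ((hasFDerivAt_id y).const_sub x)
  have h' : fderiv ℝ (fun y => ψ (x - y)) y = _ := h.fderiv
  rw [h']
  simp

/-- The fundamental theorem of calculus for translations, tested against a tempered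
distribution. -/
lemma translate_add_sub (T : 𝓢'(Space d, ℂ)) (g : 𝓢(Space d, ℂ)) (z v : Space d) :
    T (translate (z + v) g) - T (translate z g)
      = ∫ s in (0 : ℝ)..1, T (translate (z + s • v) (∂_{v} g)) := by
  have hc : Continuous fun s : ℝ => translate (z + s • v) (∂_{v} g) :=
    (continuous_translate (∂_{v} g)).comp (by fun_prop)
  obtain ⟨G, hG, hT⟩ := exists_schwartz_integral (μ := volume.restrict (Ioc (0 : ℝ) 1)) hc
    (fun k n => (((schwartz_withSeminorms ℂ (Space d) ℂ).continuous_seminorm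
      (k, n)).comp hc).integrableOn_Ioc)
  have hGe : G = translate (z + v) g - translate z g := by
    ext y
    rw [hG, sub_apply, translate_apply, translate_apply,
      ← intervalIntegral.integral_of_le zero_le_one]
    have hder : ∀ s ∈ uIcc (0 : ℝ) 1, HasDerivAt (fun s : ℝ => g (y + (z + s • v)))
        (translate (z + s • v) (∂_{v} g) y) s := by
      intro s _
      rw [translate_apply, SchwartzMap.lineDerivOp_apply_eq_fderiv]
      have h1 : HasDerivAt (fun s : ℝ => y + (z + s • v)) v s := by
        have := ((hasDerivAt_id s).smul_const v).const_add z |>.const_add y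
        simpa using this
      exact (g.hasFDerivAt (y + (z + s • v))).comp_hasDerivAt s h1
    rw [intervalIntegral.integral_eq_sub_of_hasDerivAt hder]
    · simp
    · refine Continuous.intervalIntegrable ?_ _ _
      simp only [translate_apply]
      exact (∂_{v} g).continuous.comp (by fun_prop)
  rw [← map_sub, ← hGe, (hT T).2, intervalIntegral.integral_of_le zero_le_one]

/-- The derivative of `z ↦ T (translate z g)`. -/
def translateGrad (T : 𝓢'(Space d, ℂ)) (g : 𝓢(Space d, ℂ)) (z : Space d) : Space d →L[ℝ] ℂ :=
  ∑ i, (EuclideanSpace.proj i : Space d →L[ℝ] ℝ).smulRight (T (translate z (∂_{dir i} g)))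

lemma translateGrad_apply (T : 𝓢'(Space d, ℂ)) (g : 𝓢(Space d, ℂ)) (z v : Space d) :
    translateGrad T g z v = T (translate z (∂_{v} g)) := by
  have hT : ∀ (c : ℝ) (h : 𝓢(Space d, ℂ)), T (c • h) = c • T h := fun c h => by
    have : c • h = (c : ℂ) • h := by ext y; simp
    rw [this, map_smul]; simp
  have htr : translate z (∂_{v} g) = ∑ i, v i • translate z (∂_{dir i} g) := by
    ext y
    rw [lineDeriv_eq_sum, translate_apply]
    simp [translate_apply]
  rw [htr, map_sum]
  simp [translateGrad, hT]

lemma hasFDerivAt_translate (T : 𝓢'(Space d, ℂ)) (g : 𝓢(Space d, ℂ)) (z : Space d) :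
    HasFDerivAt (fun z => T (translate z g)) (translateGrad T g z) z := by
  have hcont : Continuous (translateGrad T g) := by
    refine continuous_finsetSum _ fun i _ => ?_
    have h1 : Continuous fun z => T (translate z (∂_{dir i} g)) :=
      (map_continuous T).comp (continuous_translate _)
    exact ((ContinuousLinearMap.smulRightL ℝ (Space d) ℂ
      (EuclideanSpace.proj i : Space d →L[ℝ] ℝ)).continuous).comp h1
  rw [hasFDerivAt_iff_isLittleO_nhds_zero, Asymptotics.isLittleO_iff]
  intro c hc
  obtain ⟨δ, hδ, hball⟩ := Metric.continuousAt_iff.1 hcont.continuousAt c hc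
  filter_upwards [Metric.ball_mem_nhds (0 : Space d) hδ] with v hv
  rw [mem_ball_zero_iff] at hv
  have hint : ∀ w : ℝ → Space d, Continuous w →
      IntervalIntegrable (fun s => translateGrad T g (w s) v) volume 0 1 := fun w hw =>
    ((hcont.comp hw).clm_apply continuous_const).intervalIntegrable _ _
  rw [translate_add_sub]
  simp only [← translateGrad_apply]
  have h1 : translateGrad T g z v = ∫ s in (0 : ℝ)..1, translateGrad T g z v := by simp
  rw [h1, ← intervalIntegral.integral_sub (hint _ (by fun_prop)) (hint _ continuous_const)]
  refine (intervalIntegral.norm_integral_le_of_norm_le_const (C := c * ‖v‖) fun s hs => ?_).trans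
    (by simp)
  rw [uIoc_of_le zero_le_one] at hs
  rw [← sub_apply]
  refine (ContinuousLinearMap.le_opNorm _ _).trans ?_
  gcongr
  rw [← dist_eq_norm]
  refine (hball ?_).le
  rw [dist_eq_norm, add_sub_cancel_left, norm_smul, Real.norm_eq_abs, abs_of_pos hs.1]
  nlinarith [hs.1, hs.2, norm_nonneg v]

/-! ### Correlation of Schwartz functions -/

lemma integrable_weight_mul_norm (ψ : 𝓢(Space d, ℂ)) (k : ℕ) :
    Integrable fun z => (1 + ‖z‖) ^ k * ‖ψ z‖ := by
  have h : Integrable fun z => 2 ^ (k - 1) * (‖ψ z‖ + ‖z‖ ^ k * ‖ψ z‖) :=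
    (ψ.integrable.norm.add (ψ.integrable_pow_mul volume k)).const_mul _
  refine h.mono' (Continuous.aestronglyMeasurable (by have := ψ.continuous; fun_prop))
    (.of_forall fun z => ?_)
  rw [Real.norm_of_nonneg (by positivity)]
  have h1 := add_pow_le zero_le_one (norm_nonneg z) k
  calc (1 + ‖z‖) ^ k * ‖ψ z‖ ≤ (2 ^ (k - 1) * (1 ^ k + ‖z‖ ^ k)) * ‖ψ z‖ := by gcongr
    _ = _ := by rw [one_pow]; ring

lemma continuous_seminorm_comp {X : Type*} [TopologicalSpace X] {Φ : X → 𝓢(Space d, ℂ)}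
    (hΦ : Continuous Φ) (k n : ℕ) : Continuous fun x => SchwartzMap.seminorm ℂ k n (Φ x) :=
  ((schwartz_withSeminorms ℂ (Space d) ℂ).continuous_seminorm (k, n)).comp hΦ

/-- Integrals of the form `∫ ψ(z) Φ(z) dz` with `Φ` of polynomial growth exist in the Schwartz
space and commute with tempered distributions. -/
lemma exists_smul_integral {ψ χ : 𝓢(Space d, ℂ)} {Φ : Space d → 𝓢(Space d, ℂ)}
    (hΦ : Continuous Φ)
    (hb : ∀ k n z, SchwartzMap.seminorm ℂ k n (Φ z) ≤ (1 + ‖z‖) ^ k * affineBound k n χ) :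
    ∃ G : 𝓢(Space d, ℂ), (∀ y, G y = ∫ z, ψ z * Φ z y) ∧
      ∀ T : 𝓢'(Space d, ℂ), T G = ∫ z, ψ z * T (Φ z) := by
  have hc : Continuous fun z => ψ z • Φ z := ψ.continuous.smul hΦ
  obtain ⟨G, hG, hT⟩ := exists_schwartz_integral (μ := volume) hc (fun k n => by
    refine ((integrable_weight_mul_norm ψ k).mul_const (affineBound k n χ)).mono'
      (continuous_seminorm_comp hc k n).aestronglyMeasurable (.of_forall fun z => ?_)
    rw [Real.norm_of_nonneg (apply_nonneg _ _), map_smul_eq_mul]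
    calc _ ≤ ‖ψ z‖ * ((1 + ‖z‖) ^ k * affineBound k n χ) := by gcongr; exact hb k n z
      _ = _ := by ring)
  refine ⟨G, fun y => by rw [hG]; rfl, fun T => ?_⟩
  rw [(hT T).2]
  simp only [map_smul, smul_eq_mul]

lemma exists_correlation (ψ g : 𝓢(Space d, ℂ)) :
    ∃ G : 𝓢(Space d, ℂ), (∀ y, G y = ∫ z, ψ z * g (y + z)) ∧
      ∀ T : 𝓢'(Space d, ℂ), T G = ∫ z, ψ z * T (translate z g) := by
  simpa only [translate_apply] using exists_smul_integral (ψ := ψ) (continuous_translate g)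
    (fun k n z => seminorm_translate_le k n z g)

/-- The correlation `y ↦ ∫ ψ(z) g(y + z) dz` of two Schwartz functions, that is, the convolution of
`g` with the reflection of `ψ`. -/
def correlation (ψ g : 𝓢(Space d, ℂ)) : 𝓢(Space d, ℂ) := (exists_correlation ψ g).choose

lemma correlation_apply (ψ g : 𝓢(Space d, ℂ)) (y : Space d) :
    correlation ψ g y = ∫ z, ψ z * g (y + z) := (exists_correlation ψ g).choose_spec.1 y

lemma dist_correlation (T : 𝓢'(Space d, ℂ)) (ψ g : 𝓢(Space d, ℂ)) :
    T (correlation ψ g) = ∫ z, ψ z * T (translate z g) := (exists_correlation ψ g).choose_spec.2 T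

/-- Moving a convolution from the distribution to the test function:
`∫ g (T * ψ) = ⟨T, correlation ψ g⟩`. -/
lemma dist_correlation' (T : 𝓢'(Space d, ℂ)) (ψ g : 𝓢(Space d, ℂ)) :
    T (correlation ψ g) = ∫ x, g x * T (reflectAt ψ x) := by
  obtain ⟨G, hG, hT⟩ := exists_smul_integral (ψ := g) (continuous_reflectAt ψ)
    (fun k n x => seminorm_reflectAt_le k n x ψ)
  rw [← hT]
  congr 1
  ext y
  rw [hG, correlation_apply, ← integral_sub_right_eq_self (fun z => ψ z * g (y + z)) y]
  simp only [reflectAt_apply, add_sub_cancel]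
  simp only [mul_comm]

/-- A continuous linear functional on the Schwartz space as a tempered distribution. -/
def toDist (L : 𝓢(Space d, ℂ) →L[ℂ] ℂ) : 𝓢'(Space d, ℂ) :=
  ContinuousLinearMap.toPointwiseConvergenceCLM ℂ _ _ _ L

/-- The distribution `g ↦ ∂_v g (y)`. -/
def derivAt (v y : Space d) : 𝓢'(Space d, ℂ) :=
  toDist ((BoundedContinuousFunction.evalCLM ℂ y).comp
    ((SchwartzMap.toBoundedContinuousFunctionCLM ℂ (Space d) ℂ).comp
      (LineDeriv.lineDerivOpCLM ℂ 𝓢(Space d, ℂ) v)))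

lemma derivAt_apply (v y : Space d) (g : 𝓢(Space d, ℂ)) : derivAt v y g = ∂_{v} g y := rfl

lemma lineDeriv_correlation (v : Space d) (ψ g : 𝓢(Space d, ℂ)) :
    ∂_{v} (correlation ψ g) = correlation ψ (∂_{v} g) := by
  ext y
  rw [← derivAt_apply, dist_correlation, correlation_apply]
  simp only [derivAt_apply, lineDeriv_translate, translate_apply]

lemma lineDeriv_correlation' (v : Space d) (ψ g : 𝓢(Space d, ℂ)) :
    ∂_{v} (correlation ψ g) = - correlation (∂_{v} ψ) g := by
  ext y
  rw [← derivAt_apply, dist_correlation', neg_apply, correlation_apply,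
    ← integral_sub_right_eq_self (fun z => (∂_{v} ψ : 𝓢(Space d, ℂ)) z * g (y + z)) y,
    ← integral_neg]
  simp only [derivAt_apply, lineDeriv_reflectAt, neg_apply, reflectAt_apply, add_sub_cancel]
  congr 1
  ext z
  ring

/-! ### Tame norms -/

/-- A function `N` on the Schwartz space is tame, with weight exponent `K`, if it is the supremum of
`‖T ·‖` over the tempered distributions `T` that it dominates, and if translations by `z` increase
it by at most the factor `(1 + ‖z‖)^K`. -/
structure IsTame (K : ℕ) (N : 𝓢(Space d, ℂ) → ℝ) : Prop where
  nonneg : ∀ g, 0 ≤ N g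
  le_of_dist : ∀ g c, 0 ≤ c → (∀ T : 𝓢'(Space d, ℂ), (∀ h, ‖T h‖ ≤ N h) → ‖T g‖ ≤ c) → N g ≤ c
  translate_le : ∀ z g, N (translate z g) ≤ (1 + ‖z‖) ^ K * N g

lemma isTame_toLp (p : ℝ≥0∞) [Fact (1 ≤ p)] :
    IsTame 0 fun g : 𝓢(Space d, ℂ) => ‖g.toLp p volume‖ where
  nonneg _ := norm_nonneg _
  le_of_dist g c _ h := by
    obtain ⟨l, hl, hlg⟩ := exists_dual_vector'' ℂ (g.toLp p volume)
    have := h (toDist (l.comp (SchwartzMap.toLpCLM ℂ ℂ p volume))) (fun h => by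
      refine (l.le_opNorm _).trans ?_
      exact mul_le_of_le_one_left (norm_nonneg _) hl)
    have h2 : toDist (l.comp (SchwartzMap.toLpCLM ℂ ℂ p volume)) g = l (g.toLp p volume) := rfl
    rw [h2, hlg] at this
    simpa using this
  translate_le z g := by
    have he : eLpNorm (translate z g) p volume = eLpNorm g p volume := by
      rw [show (translate z g : Space d → ℂ) = g ∘ (· + z) from funext (translate_apply z g)]
      exact eLpNorm_comp_measurePreserving g.continuous.aestronglyMeasurable
        (measurePreserving_add_right volume z)
    simp only [SchwartzMap.norm_toLp, he, pow_zero, one_mul, le_refl]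

lemma one_add_norm_add_le (x z : Space d) : 1 + ‖x + z‖ ≤ (1 + ‖z‖) * (1 + ‖x‖) := by
  nlinarith [norm_add_le x z, mul_nonneg (norm_nonneg z) (norm_nonneg x)]

/-- Every tempered distribution is dominated by a tame norm, the supremum of its translates with
a polynomial weight. -/
lemma exists_isTame_dist (T : 𝓢'(Space d, ℂ)) :
    ∃ (K : ℕ) (N : 𝓢(Space d, ℂ) → ℝ), IsTame K N ∧ ∀ g, ‖T g‖ ≤ N g := by
  have hc : Continuous ((normSeminorm ℂ ℂ).comp (T : 𝓢(Space d, ℂ) →ₗ[ℂ] ℂ)) :=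
    continuous_norm.comp (map_continuous T)
  obtain ⟨s, C, -, hC⟩ := Seminorm.bound_of_continuous
    (schwartz_withSeminorms ℂ (Space d) ℂ) _ hc
  set K := s.sup Prod.fst with hK
  have hbound : ∀ g, ∃ M, ∀ x, ‖T (translate x g)‖ / (1 + ‖x‖) ^ K ≤ M := by
    intro g
    refine ⟨C * ∑ i ∈ s, affineBound i.1 i.2 g, fun x => ?_⟩
    rw [div_le_iff₀ (by positivity)]
    refine (hC (translate x g)).trans ?_
    rw [smul_apply, NNReal.smul_def, smul_eq_mul, mul_assoc]
    gcongr
    have hnn : ∀ i ∈ s, 0 ≤ affineBound i.1 i.2 g := fun i _ => affineBound_nonneg _ _ _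
    refine Seminorm.finset_sup_apply_le
      (mul_nonneg (Finset.sum_nonneg hnn) (by positivity)) fun i hi => ?_
    refine (seminorm_translate_le i.1 i.2 x g).trans ?_
    rw [mul_comm]
    have hK' : (1 + ‖x‖) ^ i.1 ≤ (1 + ‖x‖) ^ K :=
      pow_le_pow_right₀ (by linarith [norm_nonneg x]) (Finset.le_sup (f := Prod.fst) hi)
    exact mul_le_mul (Finset.single_le_sum hnn hi) hK' (by positivity) (Finset.sum_nonneg hnn)
  let N : 𝓢(Space d, ℂ) → ℝ := fun g => ⨆ x, ‖T (translate x g)‖ / (1 + ‖x‖) ^ K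
  have hle : ∀ g x, ‖T (translate x g)‖ / (1 + ‖x‖) ^ K ≤ N g := fun g x => by
    obtain ⟨M, hM⟩ := hbound g
    exact le_ciSup (f := fun x => ‖T (translate x g)‖ / (1 + ‖x‖) ^ K)
      ⟨M, by rintro _ ⟨x, rfl⟩; exact hM x⟩ x
  refine ⟨K, N, ⟨fun g => Real.iSup_nonneg fun x => by positivity, fun g c hc h => ?_,
    fun z g => ciSup_le fun x => ?_⟩, fun g => by simpa [translate_zero] using hle g 0⟩
  · refine ciSup_le fun x => ?_
    let L : 𝓢(Space d, ℂ) →L[ℂ] ℂ := (((1 + ‖x‖) ^ K : ℝ) : ℂ)⁻¹ •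
      ((⟨(T : 𝓢(Space d, ℂ) →ₗ[ℂ] ℂ), map_continuous T⟩ : 𝓢(Space d, ℂ) →L[ℂ] ℂ).comp
        (SchwartzMap.compSubConstCLM ℂ (-x)))
    have hL : ∀ g, ‖toDist L g‖ = ‖T (translate x g)‖ / (1 + ‖x‖) ^ K := fun g => by
      have : toDist L g = (((1 + ‖x‖) ^ K : ℝ) : ℂ)⁻¹ * T (translate x g) := rfl
      rw [this, norm_mul, norm_inv, Complex.norm_real, Real.norm_of_nonneg (by positivity),
        inv_mul_eq_div]
    rw [← hL]
    exact h _ fun g => (hL g).le.trans (hle g x)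
  · rw [translate_translate, div_le_iff₀ (by positivity)]
    have h1 := hle g (x + z)
    rw [div_le_iff₀ (by positivity)] at h1
    have h2 : (0 : ℝ) ≤ N g := le_trans (by positivity) (hle g 0)
    calc _ ≤ N g * (1 + ‖x + z‖) ^ K := h1
      _ ≤ N g * ((1 + ‖z‖) * (1 + ‖x‖)) ^ K := by gcongr; exact one_add_norm_add_le x z
      _ = _ := by rw [mul_pow]; ring

namespace IsTame

variable {K : ℕ} {N : 𝓢(Space d, ℂ) → ℝ}

lemma sub_le (hN : IsTame K N) (g h : 𝓢(Space d, ℂ)) : N (g - h) ≤ N g + N h := by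
  refine hN.le_of_dist _ _ (add_nonneg (hN.nonneg g) (hN.nonneg h)) fun T hT => ?_
  rw [map_sub]
  exact (norm_sub_le _ _).trans (add_le_add (hT g) (hT h))

lemma norm_translate_le (hN : IsTame K N) {T : 𝓢'(Space d, ℂ)} (hT : ∀ h, ‖T h‖ ≤ N h)
    (z : Space d) (g : 𝓢(Space d, ℂ)) : ‖T (translate z g)‖ ≤ (1 + ‖z‖) ^ K * N g :=
  (hT _).trans (hN.translate_le z g)

lemma correlation_le (hN : IsTame K N) (ψ g : 𝓢(Space d, ℂ)) :
    N (correlation ψ g) ≤ (∫ z, (1 + ‖z‖) ^ K * ‖ψ z‖) * N g := by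
  have h0 : 0 ≤ ∫ z, (1 + ‖z‖) ^ K * ‖ψ z‖ := integral_nonneg fun z => by positivity
  refine hN.le_of_dist _ _ (mul_nonneg h0 (hN.nonneg g)) fun T hT => ?_
  rw [dist_correlation, ← integral_mul_const]
  refine norm_integral_le_of_norm_le ((integrable_weight_mul_norm ψ K).mul_const _)
    (.of_forall fun z => ?_)
  rw [norm_mul]
  calc _ ≤ ‖ψ z‖ * ((1 + ‖z‖) ^ K * N g) := by gcongr; exact hN.norm_translate_le hT z g
    _ = _ := by ring

/-- First order Taylor estimate for translations. -/
lemma norm_sub_translate_le (hN : IsTame K N) {T : 𝓢'(Space d, ℂ)} (hT : ∀ h, ‖T h‖ ≤ N h)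
    (v : Space d) (g : 𝓢(Space d, ℂ)) :
    ‖T g - T (translate v g)‖ ≤ ‖v‖ * (1 + ‖v‖) ^ K * ∑ i : Fin d, N (∂_{dir i} g) := by
  have h := translate_add_sub T g 0 v
  rw [zero_add, translate_zero] at h
  rw [norm_sub_rev, h]
  refine (intervalIntegral.norm_integral_le_of_norm_le_const
    (C := ‖v‖ * (1 + ‖v‖) ^ K * ∑ i : Fin d, N (∂_{dir i} g)) fun s hs => ?_).trans (by simp)
  rw [uIoc_of_le zero_le_one] at hs
  have hsv : ‖(0 : Space d) + s • v‖ ≤ ‖v‖ := by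
    rw [zero_add, norm_smul, Real.norm_eq_abs, abs_of_pos hs.1]
    exact mul_le_of_le_one_left (norm_nonneg _) hs.2
  rw [← translateGrad_apply, translateGrad, sum_apply, Finset.mul_sum]
  refine (norm_sum_le _ _).trans (Finset.sum_le_sum fun i _ => ?_)
  rw [ContinuousLinearMap.smulRight_apply, norm_smul, mul_assoc]
  gcongr
  · exact PiLp.norm_apply_le v i
  · refine (hN.norm_translate_le hT _ _).trans ?_
    have := hN.nonneg (∂_{dir i} g)
    gcongr

end IsTame

/-- The scaled form of `dist_correlation`, with the scale moved from the mollifier to the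
translations. -/
lemma dist_correlation_deltaNet (T : 𝓢'(Space d, ℂ)) (φ g : 𝓢(Space d, ℂ))
    (ε : Ioo (0 : ℝ) 1) :
    T (correlation (deltaNet φ ε) g) = ∫ u, φ u * T (translate ((ε : ℝ) • u) g) := by
  have hε : (0 : ℝ) < ε := ε.2.1
  rw [dist_correlation]
  have h := Measure.integral_comp_smul (volume : Measure (Space d))
    (fun z => φ ((ε : ℝ)⁻¹ • z) * T (translate z g)) (ε : ℝ)
  simp only [inv_smul_smul₀ hε.ne', finrank_euclideanSpace_fin] at h
  rw [h, abs_of_pos (by positivity), ← integral_smul]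
  simp only [deltaNet_apply, smul_mul_assoc]

namespace IsTame

variable {K : ℕ} {N : 𝓢(Space d, ℂ) → ℝ}

lemma norm_translate_smul_le (hN : IsTame K N) {T : 𝓢'(Space d, ℂ)} (hT : ∀ h, ‖T h‖ ≤ N h)
    (ε : Ioo (0 : ℝ) 1) (u : Space d) (g : 𝓢(Space d, ℂ)) :
    ‖T (translate ((ε : ℝ) • u) g)‖ ≤ (1 + ‖u‖) ^ K * N g := by
  refine (hN.norm_translate_le hT _ _).trans ?_
  have := hN.nonneg g
  gcongr
  rw [norm_smul, Real.norm_eq_abs, abs_of_pos ε.2.1]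
  exact mul_le_of_le_one_left (norm_nonneg _) ε.2.2.le

lemma correlation_deltaNet_le (hN : IsTame K N) (φ g : 𝓢(Space d, ℂ)) (ε : Ioo (0 : ℝ) 1) :
    N (correlation (deltaNet φ ε) g) ≤ (∫ z, (1 + ‖z‖) ^ K * ‖φ z‖) * N g := by
  have h0 : 0 ≤ ∫ z, (1 + ‖z‖) ^ K * ‖φ z‖ := integral_nonneg fun z => by positivity
  refine hN.le_of_dist _ _ (mul_nonneg h0 (hN.nonneg g)) fun T hT => ?_
  rw [dist_correlation_deltaNet, ← integral_mul_const]
  refine norm_integral_le_of_norm_le ((integrable_weight_mul_norm φ K).mul_const _)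
    (.of_forall fun z => ?_)
  rw [norm_mul]
  calc _ ≤ ‖φ z‖ * ((1 + ‖z‖) ^ K * N g) := by
        gcongr; exact hN.norm_translate_smul_le hT ε z g
    _ = _ := by ring

/-- Smoothing at scale `ε` changes a test function by `O(ε)` times the first derivatives. -/
lemma sub_correlation_deltaNet_le (hN : IsTame K N) {φ : 𝓢(Space d, ℂ)} (hφ : ∫ x, φ x = 1)
    (g : 𝓢(Space d, ℂ)) (ε : Ioo (0 : ℝ) 1) :
    N (g - correlation (deltaNet φ ε) g)
      ≤ (∫ z, (1 + ‖z‖) ^ (K + 1) * ‖φ z‖) * (ε * ∑ i : Fin d, N (∂_{dir i} g)) := by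
  have hε : (0 : ℝ) < ε := ε.2.1
  have hsum : 0 ≤ ∑ i : Fin d, N (∂_{dir i} g) := Finset.sum_nonneg fun i _ => hN.nonneg _
  have h0 : 0 ≤ ∫ z, (1 + ‖z‖) ^ (K + 1) * ‖φ z‖ := integral_nonneg fun z => by positivity
  refine hN.le_of_dist _ _ (mul_nonneg h0 (mul_nonneg hε.le hsum)) fun T hT => ?_
  have hi1 : Integrable fun u => φ u * T g := φ.integrable.mul_const _
  have hi2 : Integrable fun u => φ u * T (translate ((ε : ℝ) • u) g) := by
    refine ((integrable_weight_mul_norm φ K).mul_const (N g)).mono'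
      (Continuous.aestronglyMeasurable ?_) (.of_forall fun u => ?_)
    · exact φ.continuous.mul ((map_continuous T).comp
        ((continuous_translate g).comp (by fun_prop)))
    · rw [norm_mul]
      calc _ ≤ ‖φ u‖ * ((1 + ‖u‖) ^ K * N g) := by
            gcongr; exact hN.norm_translate_smul_le hT ε u g
        _ = _ := by ring
  have hg : T g = ∫ u, φ u * T g := by rw [integral_mul_const, hφ, one_mul]
  rw [map_sub, dist_correlation_deltaNet, hg, ← integral_sub hi1 hi2, ← integral_mul_const]
  refine norm_integral_le_of_norm_le ((integrable_weight_mul_norm φ (K + 1)).mul_const _)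
    (.of_forall fun u => ?_)
  rw [← mul_sub, norm_mul]
  have hu : ‖(ε : ℝ) • u‖ = ε * ‖u‖ := by
    rw [norm_smul, Real.norm_eq_abs, abs_of_pos hε]
  have hu1 : (ε : ℝ) * ‖u‖ ≤ ‖u‖ := mul_le_of_le_one_left (norm_nonneg _) ε.2.2.le
  calc ‖φ u‖ * ‖T g - T (translate ((ε : ℝ) • u) g)‖
      ≤ ‖φ u‖ * (‖(ε : ℝ) • u‖ * (1 + ‖(ε : ℝ) • u‖) ^ K * ∑ i : Fin d, N (∂_{dir i} g)) := by
        gcongr; exact hN.norm_sub_translate_le hT _ _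
    _ ≤ ‖φ u‖ * (ε * (1 + ‖u‖) * (1 + ‖u‖) ^ K * ∑ i : Fin d, N (∂_{dir i} g)) := by
        rw [hu]; gcongr; linarith
    _ = _ := by rw [pow_succ]; ring

end IsTame

/-! ### Iterated residuals -/

/-- The residuals `r_n = ∏_{j < n} (1 - A_{ε_j}) g` of successive smoothings
`A_ε = correlation (deltaNet φ ε)`. -/
def residual (φ : 𝓢(Space d, ℂ)) (ε : ℕ → Ioo (0 : ℝ) 1) : ℕ → 𝓢(Space d, ℂ) → 𝓢(Space d, ℂ)
  | 0, g => g
  | n + 1, g => residual φ ε n g - correlation (deltaNet φ (ε n)) (residual φ ε n g)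

lemma lineDeriv_residual (φ : 𝓢(Space d, ℂ)) (ε : ℕ → Ioo (0 : ℝ) 1) (v : Space d) (n : ℕ)
    (g : 𝓢(Space d, ℂ)) : ∂_{v} (residual φ ε n g) = residual φ ε n (∂_{v} g) := by
  induction n with
  | zero => rfl
  | succ n ih =>
    have hsub : ∀ g h : 𝓢(Space d, ℂ), ∂_{v} (g - h) = ∂_{v} g - ∂_{v} h := fun g h => by
      rw [sub_eq_add_neg, LineDeriv.lineDerivOp_add, LineDeriv.lineDerivOp_neg, ← sub_eq_add_neg]
    rw [residual, residual, hsub, lineDeriv_correlation, ih]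

/-- A Sobolev norm of order `m` built on `N`. -/
def iteratedNorm (N : 𝓢(Space d, ℂ) → ℝ) : ℕ → 𝓢(Space d, ℂ) → ℝ
  | 0, g => N g
  | m + 1, g => N g + ∑ i : Fin d, iteratedNorm N m (∂_{dir i} g)

namespace IsTame

variable {K : ℕ} {N : 𝓢(Space d, ℂ) → ℝ}

lemma iteratedNorm_nonneg (hN : IsTame K N) (m : ℕ) (g : 𝓢(Space d, ℂ)) :
    0 ≤ iteratedNorm N m g := by
  induction m generalizing g with
  | zero => exact hN.nonneg g
  | succ m ih => exact add_nonneg (hN.nonneg g) (Finset.sum_nonneg fun i _ => ih _)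

/-- The residuals decay faster than any power of `2^{-n}`, at the cost of derivatives: the last
factors gain `ε_j` each, while the factors that are not used for a gain cost at most the
constant `B`. -/
lemma exists_residual_le (hN : IsTame K N) {φ : 𝓢(Space d, ℂ)} (hφ : ∫ x, φ x = 1) :
    ∃ B : ℝ, 1 ≤ B ∧ ∀ m : ℕ, ∃ C : ℝ, 0 ≤ C ∧ ∀ ε : ℕ → Ioo (0 : ℝ) 1,
      (∀ n, (ε n : ℝ) ≤ (1 / 2) ^ n) → ∀ n g,
        N (residual φ ε n g) ≤ C * (B * (1 / 2) ^ m) ^ n * iteratedNorm N m g := by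
  -- `I` bounds a smoothing step, `D` the error of a smoothing step
  set I := ∫ z, (1 + ‖z‖) ^ K * ‖φ z‖
  set D := ∫ z, (1 + ‖z‖) ^ (K + 1) * ‖φ z‖
  have hI : 0 ≤ I := integral_nonneg fun z => by positivity
  have hD : 0 ≤ D := integral_nonneg fun z => by positivity
  refine ⟨1 + I, by linarith, fun m => ?_⟩
  induction m with
  | zero =>
    refine ⟨1, zero_le_one, fun ε _ n g => ?_⟩
    rw [pow_zero, mul_one, one_mul]
    induction n with
    | zero => simp [residual, iteratedNorm]
    | succ n ih =>
      rw [residual]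
      calc _ ≤ N (residual φ ε n g) + N (correlation (deltaNet φ (ε n)) (residual φ ε n g)) :=
            hN.sub_le _ _
        _ ≤ N (residual φ ε n g) + I * N (residual φ ε n g) := by
            gcongr; exact hN.correlation_deltaNet_le _ _ _
        _ = (1 + I) * N (residual φ ε n g) := by ring
        _ ≤ (1 + I) * ((1 + I) ^ n * iteratedNorm N 0 g) := by gcongr
        _ = _ := by rw [pow_succ]; ring
  | succ m ih =>
    obtain ⟨C, hC, h⟩ := ih
    refine ⟨1 + D * C * 2 ^ (m + 1), by positivity, fun ε hε n g => ?_⟩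
    have hnn := fun i => hN.iteratedNorm_nonneg m (∂_{dir (d := d) i} g)
    have hS : 0 ≤ ∑ i : Fin d, iteratedNorm N m (∂_{dir i} g) := Finset.sum_nonneg fun i _ => hnn i
    have hg := hN.nonneg g
    rcases n with _ | n
    · simp only [residual, pow_zero, mul_one]
      have h1 : N g ≤ iteratedNorm N (m + 1) g := le_add_of_nonneg_right hS
      have h2 : 0 ≤ D * C * 2 ^ (m + 1) * iteratedNorm N (m + 1) g :=
        mul_nonneg (by positivity) (hN.iteratedNorm_nonneg _ _)
      linarith
    · -- the last factor gains `ε_n`; the derivatives pass to `g` through the other ones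
      rw [residual]
      refine (hN.sub_correlation_deltaNet_le hφ _ _).trans ?_
      simp only [lineDeriv_residual]
      calc D * (ε n * ∑ i : Fin d, N (residual φ ε n (∂_{dir i} g)))
          ≤ D * ((1 / 2) ^ n * ∑ i : Fin d, C * ((1 + I) * (1 / 2) ^ m) ^ n
              * iteratedNorm N m (∂_{dir i} g)) := by
            gcongr with i
            · exact Finset.sum_nonneg fun i _ => hN.nonneg _
            · exact hε n
            · exact h ε hε n _
        _ = D * C * 2 ^ (m + 1) * (((1 + I) ^ n * ((1 / 2) ^ (m + 1)) ^ (n + 1))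
              * ∑ i : Fin d, iteratedNorm N m (∂_{dir i} g)) := by
            rw [← Finset.mul_sum, mul_pow, pow_succ ((1 / 2 : ℝ) ^ (m + 1)) n,
              pow_succ (1 / 2 : ℝ) m, mul_pow ((1 / 2 : ℝ) ^ m)]
            have : (2 : ℝ) ^ (m + 1) * ((1 / 2) ^ m * (1 / 2)) = 1 := by
              rw [← pow_succ, ← mul_pow]; norm_num
            linear_combination (-(D * C * (1 + I) ^ n * ((1 / 2) ^ m) ^ n * (1 / 2) ^ n
              * ∑ i : Fin d, iteratedNorm N m (∂_{dir i} g))) * this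
        _ ≤ D * C * 2 ^ (m + 1) * (((1 + I) ^ (n + 1) * ((1 / 2) ^ (m + 1)) ^ (n + 1))
              * iteratedNorm N (m + 1) g) := by
            have h1 : ∑ i : Fin d, iteratedNorm N m (∂_{dir i} g) ≤ iteratedNorm N (m + 1) g :=
              le_add_of_nonneg_left hg
            gcongr
            · linarith
            · exact Nat.le_succ n
        _ ≤ (1 + D * C * 2 ^ (m + 1)) * (((1 + I) ^ (n + 1) * ((1 / 2) ^ (m + 1)) ^ (n + 1))
              * iteratedNorm N (m + 1) g) := by
            have := hN.iteratedNorm_nonneg (m + 1) g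
            gcongr
            linarith
        _ = _ := by rw [mul_pow]; ring

end IsTame

/-! ### Duality of Lebesgue norms -/

lemma enorm_integral_mul_le {p q : ℝ≥0∞} [p.HolderConjugate q] {f g : Space d → ℂ}
    (hf : Continuous f) (hg : Continuous g) :
    ‖∫ x, g x * f x‖ₑ ≤ eLpNorm f p volume * eLpNorm g q volume := by
  refine (enorm_integral_le_lintegral_enorm _).trans ?_
  rw [← eLpNorm_one_eq_lintegral_enorm]
  have := eLpNorm_smul_le_mul_eLpNorm (p := p) (q := q) (r := 1) (μ := volume)
    hg.aestronglyMeasurable hf.aestronglyMeasurable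
  refine le_trans (le_of_eq ?_) this
  congr 1
  ext x
  simp [mul_comm]

/-- If the pairing of `f` with test functions is bounded by `M` times the `L^1`-norm, then `f` is
bounded by `M`: one tests against normalized bump functions concentrating at the point. -/
lemma norm_le_of_forall_integral_le {f : Space d → ℂ} (hf : Continuous f) {M : ℝ≥0}
    (h : ∀ g : 𝓢(Space d, ℂ), ‖∫ x, g x * f x‖ₑ ≤ M * eLpNorm g 1 volume) (x₀ : Space d) :
    ‖f x₀‖ ≤ M := by
  by_contra hcon
  have hlt : (M : ℝ) < ‖f x₀‖ := not_le.1 hcon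
  have hpos : 0 < ‖f x₀‖ := M.coe_nonneg.trans_lt hlt
  set η := (‖f x₀‖ - M) / 2 with hη
  have hηpos : 0 < η := by rw [hη]; linarith
  obtain ⟨r, hr, hball⟩ := Metric.continuousAt_iff.1 hf.continuousAt η hηpos
  let b : ContDiffBump x₀ := ⟨r / 2, r, half_pos hr, half_lt_self hr⟩
  -- the unimodular constant `u` rotates `f x₀` to its absolute value
  let u : ℂ := starRingEnd ℂ (f x₀) / ‖f x₀‖
  have hu : ‖u‖ = 1 := by
    simp only [u, norm_div, RCLike.norm_conj, Complex.norm_real, norm_norm]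
    exact div_self hpos.ne'
  have huf : u * f x₀ = ‖f x₀‖ := by
    have h0 : ((‖f x₀‖ : ℝ) : ℂ) ≠ 0 := by exact_mod_cast hpos.ne'
    simp only [u]
    rw [div_mul_eq_mul_div, Complex.conj_mul', pow_two, mul_div_assoc, div_self h0, mul_one]
  have hsm : ContDiff ℝ (⊤ : ℕ∞) fun x => ((b.normed volume x : ℝ) : ℂ) * u :=
    (Complex.ofRealCLM.contDiff.comp b.contDiff_normed).mul contDiff_const
  have hcs : HasCompactSupport fun x => ((b.normed volume x : ℝ) : ℂ) * u :=
    HasCompactSupport.mul_right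
      (b.hasCompactSupport_normed.comp_left (g := fun t : ℝ => (t : ℂ)) Complex.ofReal_zero)
  have hg := h (hcs.toSchwartzMap hsm)
  have hgx : ∀ x, hcs.toSchwartzMap hsm x = ((b.normed volume x : ℝ) : ℂ) * u := fun _ => rfl
  have hnorm : ∀ x, ‖hcs.toSchwartzMap hsm x‖ = b.normed volume x := fun x => by
    rw [hgx, norm_mul, hu, mul_one, Complex.norm_real, Real.norm_of_nonneg (b.nonneg_normed x)]
  have h1 : eLpNorm (hcs.toSchwartzMap hsm) 1 volume = 1 := by
    rw [eLpNorm_one_eq_lintegral_enorm, ← ofReal_integral_norm_eq_lintegral_enorm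
      (hcs.toSchwartzMap hsm).integrable]
    simp only [hnorm, b.integral_normed, ENNReal.ofReal_one]
  rw [h1, mul_one] at hg
  have hg' : ‖∫ x, hcs.toSchwartzMap hsm x * f x‖ ≤ M := by
    rw [← toReal_enorm]
    exact ENNReal.toReal_le_of_le_ofReal M.coe_nonneg (by simpa using hg)
  have hbi : Integrable (b.normed volume) volume := b.integrable_normed
  have hint : ∀ F : Space d → ℂ, Continuous F →
      Integrable fun x => hcs.toSchwartzMap hsm x * F x := fun F hF =>
    ((hcs.toSchwartzMap hsm).continuous.mul hF).integrable_of_hasCompactSupport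
      (HasCompactSupport.mul_right hcs)
  have hdiff : ‖(∫ x, hcs.toSchwartzMap hsm x * f x) - (‖f x₀‖ : ℂ)‖ ≤ η := by
    have hc : ∫ x, hcs.toSchwartzMap hsm x * f x₀ = (‖f x₀‖ : ℂ) := by
      simp only [hgx, mul_assoc, huf]
      rw [integral_mul_const, integral_complex_ofReal, b.integral_normed]
      simp
    rw [← hc, ← integral_sub (hint f hf) (hint _ continuous_const)]
    calc _ ≤ ∫ x, b.normed volume x * η := by
          refine norm_integral_le_of_norm_le (hbi.mul_const η) (.of_forall fun x => ?_)
          rw [← mul_sub, norm_mul, hnorm]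
          by_cases hx : x ∈ Metric.ball x₀ r
          · have := (hball hx).le
            rw [dist_eq_norm] at this
            exact mul_le_mul_of_nonneg_left this (b.nonneg_normed x)
          · have : b.normed volume x = 0 := by
              rw [← Function.notMem_support, b.support_normed_eq]
              exact hx
            rw [this, zero_mul, zero_mul]
      _ = η := by rw [integral_mul_const, b.integral_normed, one_mul]
  have h3 : ‖f x₀‖ ≤ ‖∫ x, hcs.toSchwartzMap hsm x * f x‖
      + ‖(∫ x, hcs.toSchwartzMap hsm x * f x) - (‖f x₀‖ : ℂ)‖ := by
    calc ‖f x₀‖ = ‖(∫ x, hcs.toSchwartzMap hsm x * f x)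
          - ((∫ x, hcs.toSchwartzMap hsm x * f x) - (‖f x₀‖ : ℂ))‖ := by
          rw [sub_sub_cancel, Complex.norm_real, norm_norm]
      _ ≤ _ := norm_sub_le _ _
  linarith

/-- If the pairing with test functions is bounded by `M` times the dual norm, so is a localized
`L^r`-norm: one tests against the regularization `χ (‖f‖² + t²)^{(r - 2) / 2} conj f` of
`χ ‖f‖^{r - 2} conj f`, and lets `t` tend to zero. -/
lemma integral_cutoff_le {r : ℝ} (hr : 1 ≤ r) {q : ℝ≥0∞}
    [hq : (ENNReal.ofReal r).HolderConjugate q] {f : Space d → ℂ} (hf : ContDiff ℝ (⊤ : ℕ∞) f)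
    {M : ℝ≥0} (h : ∀ g : 𝓢(Space d, ℂ), ‖∫ x, g x * f x‖ₑ ≤ M * eLpNorm g q volume)
    {χ : Space d → ℝ} (hχ : ContDiff ℝ (⊤ : ℕ∞) χ) (hχs : HasCompactSupport χ)
    (hχ0 : ∀ x, 0 ≤ χ x) (hχ1 : ∀ x, χ x ≤ 1) : ∫ x, χ x * ‖f x‖ ^ r ≤ (M : ℝ) ^ r := by
  have hr0 : 0 < r := zero_lt_one.trans_le hr
  have hint : ∀ v : Space d → ℝ, Continuous v → Integrable fun x => χ x * v x := fun v hv =>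
    (hχ.continuous.mul hv).integrable_of_hasCompactSupport hχs.mul_right
  let u : ℝ → Space d → ℝ := fun t x => √(‖f x‖ ^ 2 + t ^ 2)
  have hupos : ∀ t, 0 < t → ∀ x, 0 < u t x := fun t ht x => Real.sqrt_pos.2 (by positivity)
  have husm : ∀ t, 0 < t → ContDiff ℝ (⊤ : ℕ∞) (u t) := fun t ht =>
    ((hf.norm_sq ℝ).add contDiff_const).sqrt fun x => by positivity
  have hupow : ∀ t, 0 < t → ∀ s : ℝ, ContDiff ℝ (⊤ : ℕ∞) fun x => u t x ^ s := fun t ht s =>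
    (husm t ht).rpow_const_of_ne fun x => (hupos t ht x).ne'
  have hsq : ∀ t x, u t x ^ 2 = ‖f x‖ ^ 2 + t ^ 2 := fun t x => Real.sq_sqrt (by positivity)
  have hfu : ∀ t x, ‖f x‖ ≤ u t x := fun t x => Real.le_sqrt_of_sq_le (by nlinarith [sq_nonneg t])
  have htu : ∀ t x, t ≤ u t x := fun t x =>
    Real.le_sqrt_of_sq_le (by nlinarith [sq_nonneg ‖f x‖])
  set I₀ := ∫ x, χ x * ‖f x‖ ^ r with hI₀
  set C := ∫ x, χ x * u 1 x ^ (r - 1) with hC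
  have hI₀nn : 0 ≤ I₀ := integral_nonneg fun x => mul_nonneg (hχ0 x) (by positivity)
  have hCnn : 0 ≤ C := integral_nonneg fun x =>
    mul_nonneg (hχ0 x) (Real.rpow_nonneg (Real.sqrt_nonneg _) _)
  -- the main inequality at regularization parameter `t`
  have key : ∀ t, 0 < t → t ≤ 1 → ∃ I, I₀ ≤ I ∧ I - t * C ≤ M * I ^ (1 - 1 / r) := by
    intro t ht ht1
    have hu := hupos t ht
    have hucont : ∀ s : ℝ, Continuous fun x => u t x ^ s := fun s => (hupow t ht s).continuous
    have hIint := hint _ (hucont r)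
    set I := ∫ x, χ x * u t x ^ r with hI
    have hInn : 0 ≤ I := integral_nonneg fun x => mul_nonneg (hχ0 x) (by have := hu x; positivity)
    refine ⟨I, ?_, ?_⟩
    · refine integral_mono (hint _ ?_) hIint fun x => ?_
      · exact hf.continuous.norm.rpow_const fun x => Or.inr hr0.le
      · have := hχ0 x
        have := hfu t x
        dsimp only
        gcongr
    let g₀ : Space d → ℂ := fun x => ((χ x * u t x ^ (r - 2) : ℝ) : ℂ) * starRingEnd ℂ (f x)
    have hgsm : ContDiff ℝ (⊤ : ℕ∞) g₀ :=
      (Complex.ofRealCLM.contDiff.comp (hχ.mul (hupow t ht _))).mul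
        (Complex.conjCLE.contDiff.comp hf)
    have hgcs : HasCompactSupport g₀ := by
      refine HasCompactSupport.mul_right ?_
      exact (hχs.mul_right (f' := fun x => u t x ^ (r - 2))).comp_left
        (g := fun s : ℝ => (s : ℂ)) Complex.ofReal_zero
    have hg := h (hgcs.toSchwartzMap hgsm)
    have hgx : ∀ x, hgcs.toSchwartzMap hgsm x = g₀ x := fun _ => rfl
    have hgn : ∀ x, ‖g₀ x‖ ≤ χ x * u t x ^ (r - 1) := fun x => by
      have h1 : 0 ≤ u t x ^ (r - 2) := Real.rpow_nonneg (hu x).le _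
      have h2 : u t x ^ (r - 1) = u t x ^ (r - 2) * u t x := by
        rw [← Real.rpow_add_one (hu x).ne']; congr 1; ring
      simp only [g₀]
      rw [norm_mul, RCLike.norm_conj, Complex.norm_real,
        Real.norm_of_nonneg (mul_nonneg (hχ0 x) h1), h2, mul_assoc]
      have := hχ0 x
      have := hfu t x
      gcongr
    -- the pairing of `f` with the test function
    have hpair : ∫ x, hgcs.toSchwartzMap hgsm x * f x
        = ((∫ x, χ x * (u t x ^ (r - 2) * ‖f x‖ ^ 2) : ℝ) : ℂ) := by
      rw [← integral_complex_ofReal]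
      congr 1
      ext x
      rw [hgx]
      simp only [g₀]
      rw [mul_assoc, Complex.conj_mul']
      push_cast
      ring
    have hlow : I - t * C ≤ ∫ x, χ x * (u t x ^ (r - 2) * ‖f x‖ ^ 2) := by
      rw [hI, hC, ← integral_const_mul, ← integral_sub hIint
        ((hint _ ((hupow 1 one_pos _).continuous)).const_mul t)]
      refine integral_mono (hIint.sub ((hint _ ((hupow 1 one_pos _).continuous)).const_mul t))
        (hint _ ((hucont _).mul (hf.continuous.norm.pow 2))) fun x => ?_
      have hux := hu x
      have h1 : u t x ^ r = u t x ^ (r - 2) * u t x ^ 2 := by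
        rw [← Real.rpow_add_natCast hux.ne']; congr 1; push_cast; ring
      have h2 : u t x ^ (r - 1) = u t x ^ (r - 2) * u t x := by
        rw [← Real.rpow_add_one hux.ne']; congr 1; ring
      have h3 : u t x ^ (r - 1) ≤ u 1 x ^ (r - 1) := by
        refine Real.rpow_le_rpow hux.le (Real.sqrt_le_sqrt ?_) (by linarith)
        nlinarith
      have h4 : 0 ≤ u t x ^ (r - 2) := Real.rpow_nonneg hux.le _
      have h5 : t * (t * u t x ^ (r - 2)) ≤ t * u t x ^ (r - 1) := by
        rw [h2, mul_comm (u t x ^ (r - 2))]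
        have := htu t x
        gcongr
      have h6 : t * u t x ^ (r - 1) ≤ t * u 1 x ^ (r - 1) := by gcongr
      have h7 : u t x ^ r - t * u 1 x ^ (r - 1) ≤ u t x ^ (r - 2) * ‖f x‖ ^ 2 := by
        rw [h1, hsq]
        nlinarith
      have h8 := mul_le_mul_of_nonneg_left h7 (hχ0 x)
      dsimp only
      linarith
    have hgnorm : eLpNorm (hgcs.toSchwartzMap hgsm) q volume
        ≤ ENNReal.ofReal (I ^ (1 - 1 / r)) := by
      rcases eq_or_lt_of_le hr with hr1 | hr1
      · have hqt : q = ∞ := by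
          have := hq.conj_eq
          rw [← hr1] at this
          simpa using this
        rw [hqt, eLpNorm_exponent_top, ← hr1]
        simp only [ne_eq, one_ne_zero, not_false_eq_true, div_self, sub_self, Real.rpow_zero]
        refine essSup_le_of_ae_le _ (.of_forall fun x => ?_)
        dsimp only
        rw [← ofReal_norm]
        refine ENNReal.ofReal_le_ofReal ((hgn x).trans ?_)
        rw [← hr1, sub_self, Real.rpow_zero, mul_one]
        exact hχ1 x
      · have hconj := Real.HolderConjugate.conjExponent hr1
        set s := Real.conjExponent r with hs
        have hs1 : 1 < s := hconj.symm.lt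
        have hqs : q = ENNReal.ofReal s := by
          have h2 : (ENNReal.ofReal r).HolderConjugate (ENNReal.ofReal s) :=
            Real.HolderConjugate.ennrealOfReal hconj
          exact ENNReal.HolderConjugate.unique (ENNReal.ofReal r) q (ENNReal.ofReal s)
        have hs0 : 0 < s := zero_lt_one.trans hs1
        have hexp : 1 / s = 1 - 1 / r := by
          have := hconj.inv_add_inv_eq_one
          rw [one_div, one_div]
          linarith
        rw [hqs, eLpNorm_eq_lintegral_rpow_enorm_toReal (by simpa using hs0) ENNReal.ofReal_ne_top,
          ENNReal.toReal_ofReal hs0.le, hexp,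
          ← ENNReal.ofReal_rpow_of_nonneg hInn (by rw [← hexp]; positivity)]
        refine ENNReal.rpow_le_rpow ?_ (by rw [← hexp]; positivity)
        rw [hI, ofReal_integral_eq_lintegral_ofReal hIint
          (.of_forall fun x => mul_nonneg (hχ0 x) (by have := hu x; positivity))]
        refine lintegral_mono fun x => ?_
        dsimp only
        have hux := hu x
        rw [← ofReal_norm, ENNReal.ofReal_rpow_of_nonneg (norm_nonneg _) hs0.le]
        refine ENNReal.ofReal_le_ofReal ?_
        calc ‖hgcs.toSchwartzMap hgsm x‖ ^ s ≤ (χ x * u t x ^ (r - 1)) ^ s := by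
              gcongr; exact hgn x
          _ = χ x ^ s * u t x ^ r := by
              rw [Real.mul_rpow (hχ0 x) (by positivity), ← Real.rpow_mul hux.le,
                hconj.sub_one_mul_conj]
          _ ≤ χ x * u t x ^ r := by
              gcongr
              calc χ x ^ s ≤ χ x ^ (1 : ℝ) :=
                    Real.rpow_le_rpow_of_exponent_ge' (hχ0 x) (hχ1 x) zero_le_one hs1.le
                _ = χ x := Real.rpow_one _
    refine hlow.trans ?_
    rw [hpair] at hg
    have h9 := hg.trans (mul_le_mul_right hgnorm _)
    rw [← ofReal_norm, Complex.norm_real,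
      show (M : ℝ≥0∞) = ENNReal.ofReal M by simp, ← ENNReal.ofReal_mul M.coe_nonneg,
      ENNReal.ofReal_le_ofReal_iff (by positivity)] at h9
    exact (le_abs_self _).trans h9
  rcases hI₀nn.eq_or_lt with h0 | h0
  · rw [← h0]; positivity
  have hroot : I₀ ^ (1 / r) ≤ M := by
    set c := C / I₀ ^ (1 - 1 / r) with hc
    have hcnn : 0 ≤ c := by positivity
    refine le_of_forall_pos_le_add fun η hη => ?_
    obtain ⟨I, hII, hkey⟩ := key (min 1 (η / (c + 1))) (by positivity) (min_le_left _ _)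
    set t := min 1 (η / (c + 1))
    have ht0 : 0 ≤ t := by positivity
    have hIpos : 0 < I := h0.trans_le hII
    have hexp0 : 0 ≤ 1 - 1 / r := by
      rw [sub_nonneg, div_le_one hr0]; exact hr
    have h1 : I = I ^ (1 - 1 / r) * I ^ (1 / r) := by
      rw [← Real.rpow_add hIpos]; simp
    have h2 : 0 < I ^ (1 - 1 / r) := Real.rpow_pos_of_pos hIpos _
    have h3 : I₀ ^ (1 - 1 / r) ≤ I ^ (1 - 1 / r) := by gcongr
    have h4 : C ≤ c * I ^ (1 - 1 / r) := by
      calc C = c * I₀ ^ (1 - 1 / r) := by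
            rw [hc, div_mul_cancel₀]; exact (Real.rpow_pos_of_pos h0 _).ne'
        _ ≤ _ := by gcongr
    have h5 : t * c ≤ η := by
      calc t * c ≤ η / (c + 1) * (c + 1) := by
            gcongr
            · exact min_le_right _ _
            · linarith
        _ = η := by field_simp
    have h6 : I ^ (1 / r) ≤ M + t * c := by
      refine le_of_mul_le_mul_left ?_ h2
      calc I ^ (1 - 1 / r) * I ^ (1 / r) = I := h1.symm
        _ ≤ M * I ^ (1 - 1 / r) + t * C := by linarith
        _ ≤ M * I ^ (1 - 1 / r) + t * (c * I ^ (1 - 1 / r)) := by gcongr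
        _ = _ := by ring
    calc I₀ ^ (1 / r) ≤ I ^ (1 / r) := by gcongr
      _ ≤ M + t * c := h6
      _ ≤ M + η := by gcongr
  calc I₀ = (I₀ ^ (1 / r)) ^ r := by
        rw [← Real.rpow_mul hI₀nn, one_div_mul_cancel hr0.ne', Real.rpow_one]
    _ ≤ _ := by gcongr

/-- The converse of Hölder's inequality for smooth functions, which are not assumed to lie in
`L^p`. -/
theorem eLpNorm_le_of_forall_integral_le {p : ℝ≥0∞} (hp : 1 ≤ p) {f : Space d → ℂ}
    (hf : ContDiff ℝ (⊤ : ℕ∞) f) {M : ℝ≥0}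
    (h : ∀ g : 𝓢(Space d, ℂ), ‖∫ x, g x * f x‖ₑ ≤ M * eLpNorm g p.conjExponent volume) :
    eLpNorm f p volume ≤ M := by
  rcases eq_or_ne p ∞ with rfl | hpt
  · rw [eLpNorm_exponent_top]
    refine essSup_le_of_ae_le _ (.of_forall fun x => ?_)
    have := norm_le_of_forall_integral_le hf.continuous (M := M)
      (fun g => by simpa [ENNReal.conjExponent] using h g) x
    rw [enorm_le_coe]
    exact this
  have hr : 1 ≤ p.toReal := by
    have := (ENNReal.toReal_le_toReal ENNReal.one_ne_top hpt).2 hp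
    simpa using this
  have hp0 : p ≠ 0 := (zero_lt_one.trans_le hp).ne'
  set r := p.toReal with hrdef
  have hr0 : 0 < r := zero_lt_one.trans_le hr
  have hpr : ENNReal.ofReal r = p := ENNReal.ofReal_toReal hpt
  have hconj : (ENNReal.ofReal r).HolderConjugate p.conjExponent := by
    rw [hpr]; exact ENNReal.HolderConjugate.conjExponent hp
  rw [eLpNorm_eq_lintegral_rpow_enorm_toReal hp0 hpt, ← hrdef]
  have hball : ∀ n : ℕ, ∫⁻ x in Metric.ball (0 : Space d) (n + 1), ‖f x‖ₑ ^ r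
      ≤ (M : ℝ≥0∞) ^ r := by
    intro n
    let b : ContDiffBump (0 : Space d) := ⟨n + 1, n + 2, by positivity, by linarith⟩
    have hI := integral_cutoff_le hr hf h (χ := b) b.contDiff b.hasCompactSupport
      (fun x => b.nonneg) (fun x => b.le_one)
    have hint : Integrable fun x => b x * ‖f x‖ ^ r :=
      (b.continuous.mul (hf.continuous.norm.rpow_const fun x =>
        Or.inr hr0.le)).integrable_of_hasCompactSupport b.hasCompactSupport.mul_right
    calc _ = ∫⁻ x in Metric.ball (0 : Space d) (n + 1), ENNReal.ofReal (b x * ‖f x‖ ^ r) := by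
          refine setLIntegral_congr_fun measurableSet_ball fun x hx => ?_
          have : b x = 1 := b.one_of_mem_closedBall (Metric.ball_subset_closedBall hx)
          rw [this, one_mul, ← ENNReal.ofReal_rpow_of_nonneg (norm_nonneg _) hr0.le,
            ofReal_norm]
      _ ≤ ∫⁻ x, ENNReal.ofReal (b x * ‖f x‖ ^ r) := setLIntegral_le_lintegral _ _
      _ = ENNReal.ofReal (∫ x, b x * ‖f x‖ ^ r) :=
          (ofReal_integral_eq_lintegral_ofReal hint (.of_forall fun x =>
            mul_nonneg b.nonneg (by positivity))).symm
      _ ≤ ENNReal.ofReal ((M : ℝ) ^ r) := ENNReal.ofReal_le_ofReal hI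
      _ = _ := by rw [← ENNReal.ofReal_rpow_of_nonneg M.coe_nonneg hr0.le]; simp
  have huniv : (⋃ n : ℕ, Metric.ball (0 : Space d) (n + 1)) = univ := by
    refine eq_univ_of_forall fun x => mem_iUnion.2 ?_
    obtain ⟨n, hn⟩ := exists_nat_gt ‖x‖
    exact ⟨n, by rw [mem_ball_zero_iff]; linarith⟩
  have htot : ∫⁻ x, ‖f x‖ₑ ^ r ≤ (M : ℝ≥0∞) ^ r := by
    rw [← setLIntegral_univ, ← huniv, setLIntegral_iUnion_of_directed]
    · exact iSup_le hball
    · refine Monotone.directed_le fun m n hmn => Metric.ball_subset_ball ?_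
      have : (m : ℝ) ≤ n := by exact_mod_cast hmn
      linarith
  calc _ ≤ ((M : ℝ≥0∞) ^ r) ^ (1 / r) := by gcongr
    _ = M := by rw [← ENNReal.rpow_mul, mul_one_div_cancel hr0.ne', ENNReal.rpow_one]

/-! ### Partial derivatives of Schwartz functions and of mollifications -/

lemma partialDeriv_schwartz {n : ℕ} (v : Fin n → Fin d) (ψ : 𝓢(Space d, ℂ)) :
    partialDeriv v ψ = ∂^{fun i => dir (v i)} ψ := by
  ext x
  exact SchwartzMap.iteratedLineDerivOp_eq_iteratedFDeriv.symm

lemma partialDeriv_fin_zero (v : Fin 0 → Fin d) (f : Space d → ℂ) : partialDeriv v f = f := by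
  ext x
  simp [partialDeriv]

lemma lineDeriv_smul_real (v : Space d) (c : ℝ) (g : 𝓢(Space d, ℂ)) :
    ∂_{v} (c • g) = c • ∂_{v} g :=
  map_smul (LineDeriv.lineDerivOpCLM ℝ 𝓢(Space d, ℂ) v) c g

lemma dist_smul_real (T : 𝓢'(Space d, ℂ)) (c : ℝ) (g : 𝓢(Space d, ℂ)) :
    T (c • g) = c • T g := by
  have : c • g = (c : ℂ) • g := by ext y; simp
  rw [this, map_smul]
  simp

lemma reflectAt_smul_real (c : ℝ) (ψ : 𝓢(Space d, ℂ)) (x : Space d) :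
    reflectAt (c • ψ) x = c • reflectAt ψ x := by
  ext y
  simp [reflectAt_apply]

lemma translate_reflectAt (x : Space d) (ψ : 𝓢(Space d, ℂ)) :
    translate (-x) (reflectAt ψ 0) = reflectAt ψ x := by
  ext y
  rw [translate_apply, reflectAt_apply, reflectAt_apply]
  congr 1
  abel

/-- The derivative of `T * ψ` is given by the convolutions of `T` with the partial derivatives
of `ψ`. -/
lemma hasFDerivAt_convolution (T : 𝓢'(Space d, ℂ)) (ψ : 𝓢(Space d, ℂ)) (x : Space d) :
    HasFDerivAt (fun x => T (reflectAt ψ x))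
      (∑ i, (EuclideanSpace.proj i : Space d →L[ℝ] ℝ).smulRight
        (T (reflectAt (∂_{dir i} ψ) x))) x := by
  have h := (hasFDerivAt_translate T (reflectAt ψ 0) (-x)).comp x (hasFDerivAt_id x).neg
  have hf : (fun z => T (translate z (reflectAt ψ 0))) ∘ (fun x => -id x)
      = fun x => T (reflectAt ψ x) := by
    ext x
    simp only [Function.comp_apply, id, translate_reflectAt]
  have hneg : ∀ (i : Fin d), T (translate (-x) (∂_{dir i} (reflectAt ψ 0)))
      = - T (reflectAt (∂_{dir i} ψ) x) := fun i => by
    rw [lineDeriv_reflectAt, ← translate_reflectAt x, ← map_neg]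
    congr 1
  change HasFDerivAt ((fun z => T (translate z (reflectAt ψ 0))) ∘ (fun x => -id x)) _ x at h
  rw [hf] at h
  refine h.congr_fderiv ?_
  ext v
  simp [translateGrad, hneg]

/-- A class of families of functions that is closed under partial derivatives and consists of
jointly continuous families consists of smooth families. -/
lemma contDiff_of_closed_class {X : Type*} [TopologicalSpace X] {S : Set (X → Space d → ℂ)}
    (hcont : ∀ f ∈ S, Continuous fun z : X × Space d => f z.1 z.2)
    (hder : ∀ f ∈ S, ∃ g : Fin d → X → Space d → ℂ, (∀ i, g i ∈ S) ∧ ∀ x y,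
      HasFDerivAt (f x) (∑ i, (EuclideanSpace.proj i : Space d →L[ℝ] ℝ).smulRight (g i x y)) y)
    (n : ℕ) : ∀ f ∈ S, (∀ x, ContDiff ℝ n (f x)) ∧
      Continuous fun z : X × Space d => iteratedFDeriv ℝ n (f z.1) z.2 := by
  induction n with
  | zero =>
    intro f hf
    refine ⟨fun x => contDiff_zero.2 ((hcont f hf).comp (by fun_prop :
      Continuous fun y => (x, y))), ?_⟩
    simp only [iteratedFDeriv_zero_eq_comp, Function.comp_apply]
    exact (LinearIsometryEquiv.continuous _).comp (hcont f hf)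
  | succ n ih =>
    intro f hf
    obtain ⟨g, hgS, hg⟩ := hder f hf
    let L : Fin d → (ℂ →L[ℝ] (Space d →L[ℝ] ℂ)) := fun i =>
      ContinuousLinearMap.smulRightL ℝ (Space d) ℂ (EuclideanSpace.proj i : Space d →L[ℝ] ℝ)
    have hg' : ∀ x y, HasFDerivAt (f x) (∑ i, L i (g i x y)) y := hg
    have hsm : ∀ i x, ContDiff ℝ n fun y => L i (g i x y) := fun i x =>
      (L i).contDiff.comp ((ih (g i) (hgS i)).1 x)
    refine ⟨fun x => ?_, ?_⟩
    · rw [Nat.cast_succ]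
      refine contDiff_succ_iff_hasFDerivAt.2 ⟨fun y => ∑ i, L i (g i x y),
        ContDiff.sum fun i _ => hsm i x, hg' x⟩
    · have hfd : ∀ x, fderiv ℝ (f x) = fun y => ∑ i, L i (g i x y) := fun x =>
        funext fun y => (hg' x y).fderiv
      simp only [iteratedFDeriv_succ_eq_comp_right, Function.comp_apply]
      refine (LinearIsometryEquiv.continuous _).comp ?_
      have heq : (fun z : X × Space d => iteratedFDeriv ℝ n (fderiv ℝ (f z.1)) z.2)
          = fun z => ∑ i, (ContinuousLinearMap.compContinuousMultilinearMapL ℝ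
            (fun _ : Fin n => Space d) ℂ (Space d →L[ℝ] ℂ) (L i))
              (iteratedFDeriv ℝ n (g i z.1) z.2) := by
        funext z
        rw [hfd, iteratedFDeriv_fun_sum_apply fun i _ => (hsm i z.1).contDiffAt]
        refine Finset.sum_congr rfl fun i _ => ?_
        exact (L i).iteratedFDeriv_comp_left ((ih (g i) (hgS i)).1 z.1).contDiffAt le_rfl
      rw [heq]
      exact continuous_finsetSum _ fun i _ =>
        (ContinuousLinearMap.continuous _).comp (ih (g i) (hgS i)).2

lemma lineDeriv_deltaNet (v : Space d) (ψ : 𝓢(Space d, ℂ)) (ε : Ioo (0 : ℝ) 1) :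
    ∂_{v} (deltaNet ψ ε) = (ε : ℝ)⁻¹ • deltaNet (∂_{v} ψ) ε := by
  rw [deltaNet, lineDeriv_smul_real, SchwartzMap.lineDerivOp_compCLMOfContinuousLinearEquiv]
  have h : (ContinuousLinearEquiv.smulLeft (Units.mk0 (ε : ℝ) ε.2.1.ne')⁻¹ : Space d ≃L[ℝ] _) v
      = (ε : ℝ)⁻¹ • v := rfl
  have h2 : ∂_{(ε : ℝ)⁻¹ • v} ψ = (ε : ℝ)⁻¹ • ∂_{v} ψ := LineDeriv.lineDerivOp_left_smul _ _ _
  rw [h, h2, deltaNet]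
  ext y
  simp
  ring

lemma iteratedLineDeriv_deltaNet {n : ℕ} (v : Fin n → Space d) (ψ : 𝓢(Space d, ℂ))
    (ε : Ioo (0 : ℝ) 1) :
    ∂^{v} (deltaNet ψ ε) = ((ε : ℝ)⁻¹ ^ n) • deltaNet (∂^{v} ψ) ε := by
  induction n with
  | zero => simp
  | succ n ih =>
    rw [LineDeriv.iteratedLineDerivOp_succ_left, ih, lineDeriv_smul_real, lineDeriv_deltaNet,
      ← LineDeriv.iteratedLineDerivOp_succ_left, smul_smul, pow_succ]

lemma continuous_reflectAt_deltaNet (ψ : 𝓢(Space d, ℂ)) :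
    Continuous fun z : Ioo (0 : ℝ) 1 × Space d => reflectAt (deltaNet ψ z.1) z.2 := by
  have hpos : ∀ z : Ioo (0 : ℝ) 1 × Space d, (z.1 : ℝ) ≠ 0 := fun z => z.1.2.1.ne'
  have hval : Continuous fun z : Ioo (0 : ℝ) 1 × Space d => (z.1 : ℝ) := by fun_prop
  have hinv : Continuous fun z : Ioo (0 : ℝ) 1 × Space d => (z.1 : ℝ)⁻¹ := hval.inv₀ hpos
  have h1 : Continuous fun z : Ioo (0 : ℝ) 1 × Space d =>
      ((z.1 : ℝ) ^ d) • reflectAt (deltaNet ψ z.1) z.2 := by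
    refine continuous_affine (ψ := ψ) (a := fun z => -(z.1 : ℝ)⁻¹)
      (b := fun z => (z.1 : ℝ)⁻¹ • z.2) hinv.neg (hinv.smul continuous_snd)
      (fun z => neg_ne_zero.2 (inv_ne_zero (hpos z))) fun z y => ?_
    rw [smul_apply, reflectAt_apply, deltaNet_apply, smul_smul,
      mul_inv_cancel₀ (pow_ne_zero _ (hpos z)), one_smul]
    congr 1
    rw [smul_sub, neg_smul, sub_eq_neg_add]
  have h2 := (hinv.pow d).smul h1
  refine h2.congr fun z => ?_
  change ((z.1 : ℝ)⁻¹ ^ d) • ((z.1 : ℝ) ^ d) • reflectAt (deltaNet ψ z.1) z.2 = _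
  rw [smul_smul, ← mul_pow, inv_mul_cancel₀ (hpos z), one_pow, one_smul]

/-- The mollifications of a tempered distribution form a smooth net. -/
lemma isSmoothNet_mollify (T : 𝓢'(Space d, ℂ)) (φ : 𝓢(Space d, ℂ)) :
    IsSmoothNet (mollify φ T) := by
  have h := contDiff_of_closed_class (S := {f : Net d | ∃ (j : ℕ) (ψ : 𝓢(Space d, ℂ)),
      f = fun (ε : Ioo (0 : ℝ) 1) (x : Space d) =>
        ((ε : ℝ)⁻¹ ^ j) • T (reflectAt (deltaNet ψ ε) x)}) ?_ ?_
  · have hmem : mollify φ T ∈ {f : Net d | ∃ (j : ℕ) (ψ : 𝓢(Space d, ℂ)),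
        f = fun (ε : Ioo (0 : ℝ) 1) (x : Space d) =>
          ((ε : ℝ)⁻¹ ^ j) • T (reflectAt (deltaNet ψ ε) x)} :=
      ⟨0, φ, by ext ε x; rw [pow_zero, one_smul]; rfl⟩
    exact ⟨fun ε => contDiff_infty.2 fun n => (h n _ hmem).1 ε, fun n => (h n _ hmem).2⟩
  · rintro _ ⟨j, ψ, rfl⟩
    have hinv : Continuous fun z : Ioo (0 : ℝ) 1 × Space d => (z.1 : ℝ)⁻¹ :=
      Continuous.inv₀ (by fun_prop) fun z => z.1.2.1.ne'
    exact (hinv.pow j).smul ((map_continuous T).comp (continuous_reflectAt_deltaNet ψ))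
  · rintro _ ⟨j, ψ, rfl⟩
    refine ⟨fun i ε x => ((ε : ℝ)⁻¹ ^ (j + 1)) • T (reflectAt (deltaNet (∂_{dir i} ψ) ε) x),
      fun i => ⟨j + 1, ∂_{dir i} ψ, rfl⟩, fun ε x => ?_⟩
    refine ((hasFDerivAt_convolution T (deltaNet ψ ε) x).const_smul
      ((ε : ℝ)⁻¹ ^ j)).congr_fderiv ?_
    rw [Finset.smul_sum]
    refine Finset.sum_congr rfl fun i _ => ?_
    rw [lineDeriv_deltaNet, reflectAt_smul_real, dist_smul_real]
    ext v
    simp [pow_succ]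
    ring

lemma contDiff_convolution (T : 𝓢'(Space d, ℂ)) (ψ : 𝓢(Space d, ℂ)) :
    ContDiff ℝ (⊤ : ℕ∞) fun x => T (reflectAt ψ x) := by
  have h := contDiff_of_closed_class (X := Unit) (S := {f : Unit → Space d → ℂ |
      ∃ ψ : 𝓢(Space d, ℂ), f = fun _ x => T (reflectAt ψ x)}) ?_ ?_
  · exact contDiff_infty.2 fun n => (h n _ ⟨ψ, rfl⟩).1 ()
  · rintro _ ⟨ψ, rfl⟩
    exact ((map_continuous T).comp (continuous_reflectAt ψ)).comp continuous_snd
  · rintro _ ⟨ψ, rfl⟩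
    exact ⟨fun i _ x => T (reflectAt (∂_{dir i} ψ) x), fun i => ⟨∂_{dir i} ψ, rfl⟩,
      fun _ x => hasFDerivAt_convolution T ψ x⟩

lemma partialDeriv_convolution (T : 𝓢'(Space d, ℂ)) (ψ : 𝓢(Space d, ℂ)) {n : ℕ}
    (v : Fin n → Fin d) :
    partialDeriv v (fun x => T (reflectAt ψ x))
      = fun x => T (reflectAt (∂^{fun i => dir (v i)} ψ) x) := by
  induction n with
  | zero =>
    rw [partialDeriv_fin_zero]
    simp
  | succ n ih =>
    ext x
    have h := ih (fun i => v i.succ)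
    rw [partialDeriv, iteratedFDeriv_succ_apply_left,
      ← fderiv_continuousMultilinear_apply_const_apply]
    · change fderiv ℝ (partialDeriv (fun i => v i.succ) (fun x => T (reflectAt ψ x))) x
        (dir (v 0)) = _
      rw [h, (hasFDerivAt_convolution T _ x).fderiv, LineDeriv.iteratedLineDerivOp_succ_left]
      simp [Fin.tail_def]
    · exact (contDiff_convolution T ψ).differentiable_iteratedFDeriv
        (mod_cast ENat.natCast_lt_top n) x

/-! ### Sobolev norms of Schwartz functions -/

lemma eLpNorm_le_sobolevNorm {k n : ℕ} (hn : n ≤ k) (v : Fin n → Fin d) (p : ℝ≥0∞)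
    (f : Space d → ℂ) : eLpNorm (partialDeriv v f) p volume ≤ sobolevNorm k p univ f := by
  have := le_iSup₂ (f := fun (n : Fin (k + 1)) (v : Fin n → Fin d) =>
      eLpNorm (partialDeriv v f) p (volume.restrict univ)) ⟨n, Nat.lt_succ_of_le hn⟩ v
  simp only [Measure.restrict_univ] at this
  simpa only [sobolevNorm, Measure.restrict_univ] using this

lemma sobolevNorm_univ_le {k : ℕ} {p : ℝ≥0∞} {f : Space d → ℂ} {C : ℝ≥0∞}
    (h : ∀ n ≤ k, ∀ v : Fin n → Fin d, eLpNorm (partialDeriv v f) p volume ≤ C) :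
    sobolevNorm k p univ f ≤ C := by
  refine iSup₂_le fun n v => ?_
  rw [Measure.restrict_univ]
  exact h n (Nat.le_of_lt_succ n.2) v

lemma sobolevNorm_mono_set (k : ℕ) (p : ℝ≥0∞) (ω : Set (Space d)) (f : Space d → ℂ) :
    sobolevNorm k p ω f ≤ sobolevNorm k p univ f :=
  iSup₂_mono fun _ _ => eLpNorm_mono_measure _ (Measure.restrict_mono_set _ (subset_univ ω))

lemma eLpNorm_le_sobolevNorm_self (k : ℕ) (p : ℝ≥0∞) (f : Space d → ℂ) :
    eLpNorm f p volume ≤ sobolevNorm k p univ f := by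
  have := eLpNorm_le_sobolevNorm (Nat.zero_le k) Fin.elim0 p f
  rwa [partialDeriv_fin_zero] at this

lemma sobolevNorm_schwartz_lt_top (k : ℕ) (p : ℝ≥0∞) (ψ : 𝓢(Space d, ℂ)) :
    sobolevNorm k p univ ψ < ∞ := by
  have hle : sobolevNorm k p univ ψ ≤ ∑ n : Fin (k + 1), ∑ v : Fin n → Fin d,
      eLpNorm (partialDeriv v ψ) p (volume.restrict univ) := by
    refine iSup₂_le fun n v => ?_
    refine le_trans ?_ (Finset.single_le_sum (fun _ _ => zero_le) (Finset.mem_univ n))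
    exact Finset.single_le_sum (f := fun v : Fin n → Fin d =>
      eLpNorm (partialDeriv v ψ) p (volume.restrict univ)) (fun _ _ => zero_le)
      (Finset.mem_univ v)
  refine hle.trans_lt (ENNReal.sum_lt_top.2 fun n _ => ENNReal.sum_lt_top.2 fun v _ => ?_)
  rw [partialDeriv_schwartz, Measure.restrict_univ]
  exact SchwartzMap.eLpNorm_lt_top _ _ _

lemma sobolevNorm_lineDeriv_le (k : ℕ) (p : ℝ≥0∞) (i : Fin d) (g : 𝓢(Space d, ℂ)) :
    sobolevNorm k p univ (∂_{dir i} g : 𝓢(Space d, ℂ)) ≤ sobolevNorm (k + 1) p univ g := by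
  refine sobolevNorm_univ_le fun n hn v => ?_
  refine le_of_eq_of_le ?_ (eLpNorm_le_sobolevNorm (Nat.succ_le_succ hn)
    (Fin.snoc (α := fun _ => Fin d) v i) p g)
  rw [partialDeriv_schwartz, partialDeriv_schwartz, LineDeriv.iteratedLineDerivOp_succ_right]
  congr 3
  · ext1 j; simp [Fin.init]
  · simp

lemma iteratedNorm_toLp_le (p : ℝ≥0∞) (m : ℕ) (g : 𝓢(Space d, ℂ)) :
    ENNReal.ofReal (iteratedNorm (fun g : 𝓢(Space d, ℂ) => ‖g.toLp p volume‖) m g)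
      ≤ (d + 1) ^ m * sobolevNorm m p univ g := by
  have h0 : ∀ (m : ℕ) (g : 𝓢(Space d, ℂ)),
      ENNReal.ofReal ‖g.toLp p volume‖ ≤ sobolevNorm m p univ g := fun m g => by
    rw [SchwartzMap.norm_toLp, ENNReal.ofReal_toReal (g.eLpNorm_lt_top p volume).ne]
    exact eLpNorm_le_sobolevNorm_self m p g
  induction m generalizing g with
  | zero => simpa [iteratedNorm] using h0 0 g
  | succ m ih =>
    rw [iteratedNorm]
    refine ENNReal.ofReal_add_le.trans ?_
    refine (add_le_add (h0 (m + 1) g) ((Finset.le_sum_of_subadditive ENNReal.ofReal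
      ENNReal.ofReal_zero.le (fun _ _ => ENNReal.ofReal_add_le) _ _).trans
      (Finset.sum_le_sum fun i _ => (ih _).trans
        (mul_le_mul_right (sobolevNorm_lineDeriv_le m p i g) _)))).trans ?_
    rw [Finset.sum_const, Finset.card_univ, Fintype.card_fin, nsmul_eq_mul, ← mul_assoc]
    nth_rewrite 1 [← one_mul (sobolevNorm (m + 1) p univ g)]
    rw [← add_mul]
    gcongr
    rw [pow_succ', add_mul, one_mul, add_comm]
    gcongr
    exact one_le_pow₀ le_add_self

lemma sobolevNorm_iteratedLineDeriv_le (k : ℕ) (p : ℝ≥0∞) {n : ℕ} (v : Fin n → Fin d)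
    (g : 𝓢(Space d, ℂ)) :
    sobolevNorm k p univ (∂^{fun i => dir (v i)} g : 𝓢(Space d, ℂ))
      ≤ sobolevNorm (k + n) p univ g := by
  induction n generalizing k with
  | zero => simp
  | succ n ih =>
    rw [LineDeriv.iteratedLineDerivOp_succ_left]
    refine (sobolevNorm_lineDeriv_le k p (v 0) _).trans ?_
    refine (ih (k + 1) fun i => v i.succ).trans (le_of_eq ?_)
    rw [add_right_comm, add_assoc]

/-- Young's inequality for the correlation with an integrable function. -/
lemma eLpNorm_correlation_le (q : ℝ≥0∞) [Fact (1 ≤ q)] (ψ g : 𝓢(Space d, ℂ)) :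
    eLpNorm (correlation ψ g) q volume ≤ eLpNorm ψ 1 volume * eLpNorm g q volume := by
  have h := (isTame_toLp (d := d) q).correlation_le ψ g
  simp only [pow_zero, one_mul, SchwartzMap.norm_toLp] at h
  rw [← ENNReal.ofReal_toReal ((correlation ψ g).eLpNorm_lt_top q volume).ne,
    ← ENNReal.ofReal_toReal (g.eLpNorm_lt_top q volume).ne, eLpNorm_one_eq_lintegral_enorm,
    ← ofReal_integral_norm_eq_lintegral_enorm ψ.integrable,
    ← ENNReal.ofReal_mul (integral_nonneg fun _ => norm_nonneg _)]
  exact ENNReal.ofReal_le_ofReal h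

lemma iteratedLineDeriv_correlation {n : ℕ} (v : Fin n → Space d) (ψ g : 𝓢(Space d, ℂ)) :
    ∂^{v} (correlation ψ g) = ((-1 : ℝ) ^ n) • correlation (∂^{v} ψ) g := by
  induction n with
  | zero => simp
  | succ n ih =>
    rw [LineDeriv.iteratedLineDerivOp_succ_left, ih, lineDeriv_smul_real, lineDeriv_correlation',
      ← LineDeriv.iteratedLineDerivOp_succ_left, pow_succ, mul_neg_one, neg_smul, smul_neg]

/-- Young's inequality with all derivatives moved to `ψ`. -/
lemma sobolevNorm_correlation_le (k : ℕ) (q : ℝ≥0∞) [Fact (1 ≤ q)] (ψ g : 𝓢(Space d, ℂ)) :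
    sobolevNorm k q univ (correlation ψ g) ≤ sobolevNorm k 1 univ ψ * eLpNorm g q volume := by
  refine sobolevNorm_univ_le fun n hn v => ?_
  have h1 : eLpNorm (partialDeriv v (correlation ψ g)) q volume
      = eLpNorm (correlation (∂^{fun i => dir (v i)} ψ) g) q volume := by
    rw [partialDeriv_schwartz, iteratedLineDeriv_correlation]
    refine eLpNorm_congr_norm_ae (.of_forall fun x => ?_)
    rw [smul_apply, norm_smul, norm_pow, norm_neg, norm_one, one_pow, one_mul]
  rw [h1]
  refine (eLpNorm_correlation_le q _ g).trans ?_
  gcongr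
  rw [← partialDeriv_schwartz]
  exact eLpNorm_le_sobolevNorm hn v 1 ψ

lemma eLpNorm_one_deltaNet (ψ : 𝓢(Space d, ℂ)) (ε : Ioo (0 : ℝ) 1) :
    eLpNorm (deltaNet ψ ε) 1 volume = eLpNorm ψ 1 volume := by
  have hε : (0 : ℝ) < ε := ε.2.1
  rw [eLpNorm_one_eq_lintegral_enorm, eLpNorm_one_eq_lintegral_enorm,
    ← ofReal_integral_norm_eq_lintegral_enorm ψ.integrable,
    ← ofReal_integral_norm_eq_lintegral_enorm (deltaNet ψ ε).integrable]
  congr 1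
  have h := Measure.integral_comp_inv_smul (volume : Measure (Space d)) (fun x => ‖ψ x‖) (ε : ℝ)
  rw [finrank_euclideanSpace_fin, abs_of_pos (by positivity), smul_eq_mul] at h
  simp only [deltaNet_apply, norm_smul, norm_inv, norm_pow, Real.norm_of_nonneg hε.le]
  rw [integral_const_mul, h, inv_mul_cancel_left₀ (by positivity)]

lemma sobolevNorm_deltaNet_le (m : ℕ) (ψ : 𝓢(Space d, ℂ)) (ε : Ioo (0 : ℝ) 1) :
    sobolevNorm m 1 univ (deltaNet ψ ε)
      ≤ sobolevNorm m 1 univ ψ * ENNReal.ofReal ((ε : ℝ)⁻¹ ^ m) := by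
  have hε : (0 : ℝ) < ε := ε.2.1
  refine sobolevNorm_univ_le fun n hn v => ?_
  rw [partialDeriv_schwartz, iteratedLineDeriv_deltaNet]
  have h1 : ((((ε : ℝ)⁻¹ ^ n) • deltaNet (∂^{fun i => dir (v i)} ψ) ε : 𝓢(Space d, ℂ)) :
      Space d → ℂ) = ((ε : ℝ)⁻¹ ^ n) • (deltaNet (∂^{fun i => dir (v i)} ψ) ε : Space d → ℂ) := by
    ext x; rfl
  rw [h1, eLpNorm_const_smul, eLpNorm_one_deltaNet, ← partialDeriv_schwartz, mul_comm,
    ← ofReal_norm, Real.norm_of_nonneg (by positivity)]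
  gcongr
  · exact eLpNorm_le_sobolevNorm hn v 1 ψ
  · exact (one_le_inv₀ hε).2 ε.2.2.le

lemma fact_one_le_conjExponent (p : ℝ≥0∞) : Fact (1 ≤ p.conjExponent) := ⟨le_self_add⟩

/-! ### Distributions of class `𝓓'_{L^p}` have moderate mollifications -/

/-- Convolution with a Schwartz function maps `W_0^{-k,p}` to `L^p`. -/
lemma eLpNorm_convolution_le {p : ℝ≥0∞} (hp : 1 ≤ p) {k : ℕ} {T : 𝓢'(Space d, ℂ)} {C : ℝ≥0}
    (hT : ∀ g : 𝓢(Space d, ℂ), ‖T g‖ₑ ≤ C * sobolevNorm k p.conjExponent univ g)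
    (ψ : 𝓢(Space d, ℂ)) :
    eLpNorm (fun x => T (reflectAt ψ x)) p volume ≤ C * sobolevNorm k 1 univ ψ := by
  have := fact_one_le_conjExponent p
  have hfin := (sobolevNorm_schwartz_lt_top k 1 ψ).ne
  have h := eLpNorm_le_of_forall_integral_le hp (contDiff_convolution T ψ)
    (M := C * (sobolevNorm k 1 univ ψ).toNNReal) fun g => by
      rw [← dist_correlation', ENNReal.coe_mul, ENNReal.coe_toNNReal hfin, mul_assoc]
      exact (hT _).trans (mul_le_mul_right (sobolevNorm_correlation_le k _ ψ g) _)
  rwa [ENNReal.coe_mul, ENNReal.coe_toNNReal hfin] at h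

lemma sobolevNorm_convolution_le {p : ℝ≥0∞} (hp : 1 ≤ p) {k : ℕ} {T : 𝓢'(Space d, ℂ)} {C : ℝ≥0}
    (hT : ∀ g : 𝓢(Space d, ℂ), ‖T g‖ₑ ≤ C * sobolevNorm k p.conjExponent univ g) (l : ℕ)
    (ψ : 𝓢(Space d, ℂ)) :
    sobolevNorm l p univ (fun x => T (reflectAt ψ x)) ≤ C * sobolevNorm (k + l) 1 univ ψ := by
  refine sobolevNorm_univ_le fun n hn v => ?_
  rw [partialDeriv_convolution]
  refine (eLpNorm_convolution_le hp hT _).trans ?_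
  gcongr
  exact (sobolevNorm_iteratedLineDeriv_le k 1 v ψ).trans (sobolevNorm_mono (by omega) 1 univ _)

lemma volume_comap_image (A : Set (Ioo (0 : ℝ) 1)) :
    (volume.comap Subtype.val : Measure (Ioo (0 : ℝ) 1)) A = volume (Subtype.val '' A) :=
  (MeasurableEmbedding.subtype_coe measurableSet_Ioo).comap_apply volume A

/-- The weight `ε^{m + 1}` gains one power more than needed, which compensates for the singular
measure `dε/ε`. -/
lemma growth_inv_pow_lt_top {q : ℝ≥0∞} (hq : 1 ≤ q) (m : ℕ) :
    growth q (m + 1) (fun ε => ENNReal.ofReal ((ε : ℝ)⁻¹ ^ m)) < ∞ := by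
  unfold growth
  split_ifs with hqt
  · refine lt_of_le_of_lt (iSup_le fun ε => ?_) ENNReal.one_lt_top
    have hε : (0 : ℝ) < ε := ε.2.1
    rw [← ENNReal.ofReal_mul (by positivity)]
    refine ENNReal.ofReal_le_one.2 ?_
    have h : (ε : ℝ) ^ ((m : ℝ) + 1) * (ε : ℝ)⁻¹ ^ m = ε := by
      rw [Real.rpow_add_one hε.ne', Real.rpow_natCast, inv_pow]
      field_simp
    rw [h]
    exact ε.2.2.le
  · have hr : 1 ≤ q.toReal := by
      have := (ENNReal.toReal_le_toReal ENNReal.one_ne_top hqt).2 hq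
      simpa using this
    refine lt_of_le_of_lt (lintegral_mono (g := fun _ => 1) fun ε => ?_) ?_
    · have hε : (0 : ℝ) < ε := ε.2.1
      dsimp only
      rw [ENNReal.ofReal_rpow_of_nonneg (by positivity) (by linarith),
        ← ENNReal.ofReal_mul (by positivity), ← ENNReal.ofReal_mul (by positivity)]
      refine ENNReal.ofReal_le_one.2 ?_
      have h : (ε : ℝ) ^ (q.toReal * ((m : ℝ) + 1)) * ((ε : ℝ)⁻¹ ^ m) ^ q.toReal * (1 / (ε : ℝ))
          = (ε : ℝ) ^ (q.toReal - 1) := by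
        rw [← Real.rpow_natCast, ← Real.rpow_mul (by positivity), Real.inv_rpow hε.le,
          ← Real.rpow_neg hε.le, one_div, ← Real.rpow_neg_one, ← Real.rpow_add hε,
          ← Real.rpow_add hε]
        congr 1
        ring
      rw [h]
      exact Real.rpow_le_one hε.le ε.2.2.le (by linarith)
    · rw [lintegral_const, one_mul, volume_comap_image, image_univ, Subtype.range_coe]
      simp

/-- The norms `‖∂^α (T * φ_ε)‖_p` grow at most like `ε^{-(k + |α|)}` if `T ∈ W_0^{-k,p}`. -/
lemma mollify_mem_moderate {p q : ℝ≥0∞} (hp : 1 ≤ p) [hq : Fact (1 ≤ q)] (φ : 𝓢(Space d, ℂ))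
    {T : 𝓢'(Space d, ℂ)} (hT : T ∈ DPrimeLp d p) : mollify φ T ∈ moderate d p q := by
  obtain ⟨k, C, hC⟩ := hT
  have key : ∀ l : ℕ, growth q ((k + l : ℕ) + 1)
      (fun ε => sobolevNorm l p univ (mollify φ T ε)) < ∞ := by
    intro l
    refine lt_of_le_of_lt (growth_mono_fun _ _ fun ε => ?_)
      (growth_const_mul_lt_top q _ (c := C * sobolevNorm (k + l) 1 univ φ)
        (ENNReal.mul_ne_top ENNReal.coe_ne_top (sobolevNorm_schwartz_lt_top _ _ _).ne)
        (growth_inv_pow_lt_top hq.out (k + l)))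
    refine (sobolevNorm_convolution_le hp hC l (deltaNet φ ε)).trans ?_
    rw [mul_assoc]
    gcongr
    exact sobolevNorm_deltaNet_le _ φ ε
  refine fun l => ⟨((k + l : ℕ) : ℝ) + 1,
    ⟨isSmoothNet_mollify T φ, fun l ω _ _ => ⟨((k + l : ℕ) : ℝ) + 1, ?_⟩⟩, key l⟩
  exact lt_of_le_of_lt (growth_mono_fun _ _ fun ε => sobolevNorm_mono_set l p ω _) (key l)

/-! ### Selection of scales -/

/-- Finite growth yields, in every dyadic interval, a scale at which the pointwise bound of order
`ε^{-s}` holds with a uniform constant. -/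
lemma exists_dyadic_scale {q : ℝ≥0∞} (hq : 1 ≤ q) {s : ℝ} {N : Ioo (0 : ℝ) 1 → ℝ≥0∞}
    (h : growth q s N < ∞) : ∃ C : ℝ≥0, ∀ j : ℕ, ∃ ε : Ioo (0 : ℝ) 1,
      (1 / 2 : ℝ) ^ (j + 1) < ε ∧ (ε : ℝ) < (1 / 2) ^ j ∧
        N ε ≤ C * ENNReal.ofReal ((ε : ℝ) ^ (-s)) := by
  have hlt : ∀ j : ℕ, (1 / 2 : ℝ) ^ (j + 1) < (1 / 2) ^ j := fun j =>
    pow_lt_pow_right_of_lt_one₀ (by norm_num) (by norm_num) (Nat.lt_succ_self j)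
  have hpos : ∀ j : ℕ, (0 : ℝ) < (1 / 2) ^ j := fun j => by positivity
  have hone : ∀ j : ℕ, (1 / 2 : ℝ) ^ j ≤ 1 := fun j => pow_le_one₀ (by norm_num) (by norm_num)
  have hinv : ∀ ε : Ioo (0 : ℝ) 1,
      ENNReal.ofReal ((ε : ℝ) ^ s) * ENNReal.ofReal ((ε : ℝ) ^ (-s)) = 1 := fun ε => by
    have hε : (0 : ℝ) < ε := ε.2.1
    rw [← ENNReal.ofReal_mul (by positivity), ← Real.rpow_add hε]
    simp
  unfold growth at h
  split_ifs at h with hqt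
  · set I := ⨆ ε : Ioo (0 : ℝ) 1, ENNReal.ofReal ((ε : ℝ) ^ s) * N ε with hI
    refine ⟨I.toNNReal, fun j => ?_⟩
    obtain ⟨x, hx1, hx2⟩ := exists_between (hlt j)
    let ε : Ioo (0 : ℝ) 1 := ⟨x, (hpos _).trans hx1, hx2.trans_le (hone j)⟩
    refine ⟨ε, hx1, hx2, ?_⟩
    rw [ENNReal.coe_toNNReal h.ne]
    calc N ε = ENNReal.ofReal ((ε : ℝ) ^ s) * N ε * ENNReal.ofReal ((ε : ℝ) ^ (-s)) := by
          rw [mul_right_comm, hinv, one_mul]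
      _ ≤ I * _ := by
          gcongr
          exact le_iSup (fun ε : Ioo (0 : ℝ) 1 => ENNReal.ofReal ((ε : ℝ) ^ s) * N ε) ε
  · have hr : 1 ≤ q.toReal := by
      have := (ENNReal.toReal_le_toReal ENNReal.one_ne_top hqt).2 hq
      simpa using this
    have hr0 : 0 ≤ q.toReal := zero_le_one.trans hr
    set F : Ioo (0 : ℝ) 1 → ℝ≥0∞ := fun ε => ENNReal.ofReal ((ε : ℝ) ^ (q.toReal * s))
      * N ε ^ q.toReal * ENNReal.ofReal (1 / (ε : ℝ)) with hF
    set I := ∫⁻ ε, F ε ∂(volume.comap Subtype.val) with hI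
    refine ⟨2 * I.toNNReal + 1, fun j => ?_⟩
    set C : ℝ≥0 := 2 * I.toNNReal + 1 with hC
    by_contra! hcon
    let A : Set (Ioo (0 : ℝ) 1) := Subtype.val ⁻¹' Ioo ((1 / 2 : ℝ) ^ (j + 1)) ((1 / 2) ^ j)
    have hA : MeasurableSet A := measurable_subtype_coe measurableSet_Ioo
    have hvol : (volume.comap Subtype.val : Measure (Ioo (0 : ℝ) 1)) A
        = ENNReal.ofReal ((1 / 2) ^ (j + 1)) := by
      rw [volume_comap_image, Subtype.image_preimage_coe, inter_eq_right.2, Real.volume_Ioo]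
      · congr 1
        rw [pow_succ]
        ring
      · exact fun x hx => ⟨(hpos _).trans hx.1, hx.2.trans_le (hone j)⟩
    -- a violation of the bound on the whole dyadic interval makes the integral too large
    have hlow : ∀ ε ∈ A, (C : ℝ≥0∞) * ENNReal.ofReal (2 ^ j) ≤ F ε := by
      intro ε hε
      have hε0 : (0 : ℝ) < ε := ε.2.1
      have h1 := (hcon ε hε.1 hε.2).le
      have h2 : ENNReal.ofReal ((ε : ℝ) ^ (q.toReal * s))
          = ENNReal.ofReal ((ε : ℝ) ^ s) ^ q.toReal := by
        rw [mul_comm, Real.rpow_mul hε0.le, ENNReal.ofReal_rpow_of_nonneg (by positivity) hr0]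
      have h3 : (C : ℝ≥0∞) ≤ (C : ℝ≥0∞) ^ q.toReal := by
        calc (C : ℝ≥0∞) = (C : ℝ≥0∞) ^ (1 : ℝ) := (ENNReal.rpow_one _).symm
          _ ≤ _ := ENNReal.rpow_le_rpow_of_exponent_le (by exact_mod_cast le_add_self) hr
      have h4 : (2 : ℝ) ^ j ≤ 1 / (ε : ℝ) := by
        rw [le_div_iff₀ hε0]
        calc (2 : ℝ) ^ j * ε ≤ 2 ^ j * (1 / 2) ^ j := by gcongr; exact hε.2.le
          _ = 1 := by rw [← mul_pow]; norm_num
      calc (C : ℝ≥0∞) * ENNReal.ofReal (2 ^ j)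
          ≤ (C : ℝ≥0∞) ^ q.toReal * ENNReal.ofReal (1 / (ε : ℝ)) :=
            mul_le_mul' h3 (ENNReal.ofReal_le_ofReal h4)
        _ = (ENNReal.ofReal ((ε : ℝ) ^ s) * (C * ENNReal.ofReal ((ε : ℝ) ^ (-s)))) ^ q.toReal
              * ENNReal.ofReal (1 / (ε : ℝ)) := by
            rw [mul_left_comm, hinv, mul_one]
        _ ≤ (ENNReal.ofReal ((ε : ℝ) ^ s) * N ε) ^ q.toReal * ENNReal.ofReal (1 / (ε : ℝ)) := by
            gcongr
        _ = F ε := by rw [ENNReal.mul_rpow_of_nonneg _ _ hr0, ← h2]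
    have hcontra : (C : ℝ≥0∞) * ENNReal.ofReal (1 / 2) ≤ I := by
      calc (C : ℝ≥0∞) * ENNReal.ofReal (1 / 2)
          = C * ENNReal.ofReal (2 ^ j) * ENNReal.ofReal ((1 / 2) ^ (j + 1)) := by
            rw [mul_assoc, ← ENNReal.ofReal_mul (by positivity)]
            congr 2
            rw [pow_succ, ← mul_assoc, ← mul_pow]
            norm_num
        _ = ∫⁻ ε in A, C * ENNReal.ofReal (2 ^ j) ∂(volume.comap Subtype.val) := by
            rw [setLIntegral_const, hvol]
        _ ≤ ∫⁻ ε in A, F ε ∂(volume.comap Subtype.val) := setLIntegral_mono' hA hlow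
        _ ≤ I := setLIntegral_le_lintegral _ _
    rw [← ENNReal.coe_toNNReal h.ne, show ENNReal.ofReal (1 / 2) = ((1 / 2 : ℝ≥0) : ℝ≥0∞) by
      rw [ENNReal.ofReal, Real.toNNReal_div zero_le_one]; simp, ← ENNReal.coe_mul,
      ENNReal.coe_le_coe, ← NNReal.coe_le_coe, hC] at hcontra
    push_cast at hcontra
    linarith

/-! ### Distributions with moderate or negligible mollifications -/

/-- By Hölder's inequality, `⟨T, A_ε g⟩ = ∫ g (T * φ_ε)` is bounded by `‖T * φ_ε‖_p ‖g‖_{p'}`. -/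
lemma norm_dist_correlation_deltaNet_le {p : ℝ≥0∞} (hp : 1 ≤ p) (φ : 𝓢(Space d, ℂ))
    {T : 𝓢'(Space d, ℂ)} {ε : Ioo (0 : ℝ) 1} {b : ℝ} (hb : 0 ≤ b)
    (h : sobolevNorm 0 p univ (mollify φ T ε) ≤ ENNReal.ofReal b) (g : 𝓢(Space d, ℂ)) :
    ‖T (correlation (deltaNet φ ε) g)‖ ≤ b * ‖g.toLp p.conjExponent volume‖ := by
  have hconj := ENNReal.HolderConjugate.conjExponent hp
  have := fact_one_le_conjExponent p
  have hn : 0 ≤ b * ‖g.toLp p.conjExponent volume‖ := mul_nonneg hb (norm_nonneg _)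
  rw [← ENNReal.ofReal_le_ofReal_iff hn, ofReal_norm, ENNReal.ofReal_mul hb,
    SchwartzMap.norm_toLp, ENNReal.ofReal_toReal (g.eLpNorm_lt_top _ volume).ne,
    dist_correlation']
  refine (enorm_integral_mul_le (p := p) (q := p.conjExponent)
    (contDiff_convolution T _).continuous g.continuous).trans ?_
  gcongr
  exact (eLpNorm_le_sobolevNorm_self 0 p (mollify φ T ε)).trans h

/-- A tempered distribution whose mollifications are moderate lies in `𝓓'_{L^p}`. -/
lemma mem_DPrimeLp_of_mollify_mem_moderate {p q : ℝ≥0∞} (hp : 1 ≤ p) [hq : Fact (1 ≤ q)]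
    {φ : 𝓢(Space d, ℂ)} (hφ : ∫ x, φ x = 1) {T : 𝓢'(Space d, ℂ)}
    (hT : mollify φ T ∈ moderate d p q) : T ∈ DPrimeLp d p := by
  have hp' := fact_one_le_conjExponent p
  obtain ⟨s₀, -, hs₀⟩ := hT 0
  obtain ⟨σ, hσ⟩ := exists_nat_ge s₀
  obtain ⟨C, hC⟩ := exists_dyadic_scale hq.out ((growth_anti q hσ _).trans_lt hs₀)
  choose ε hε1 hε2 hε3 using hC
  have hεle : ∀ n, (ε n : ℝ) ≤ (1 / 2) ^ n := fun n => (hε2 n).le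
  have hbound : ∀ j, sobolevNorm 0 p univ (mollify φ T (ε j))
      ≤ ENNReal.ofReal (C * 2 ^ σ * (2 ^ σ) ^ j) := by
    intro j
    have hε0 : (0 : ℝ) < ε j := (ε j).2.1
    refine (hε3 j).trans ?_
    rw [mul_assoc, ENNReal.ofReal_mul C.coe_nonneg, ENNReal.ofReal_coe_nnreal]
    gcongr
    rw [Real.rpow_neg hε0.le, Real.rpow_natCast, ← inv_pow]
    calc ((ε j : ℝ)⁻¹) ^ σ ≤ (2 ^ (j + 1)) ^ σ := by
          gcongr
          rw [inv_le_comm₀ hε0 (by positivity)]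
          have := (hε1 j).le
          rwa [one_div, inv_pow] at this
      _ = 2 ^ σ * (2 ^ σ) ^ j := by
          rw [← pow_mul, ← pow_mul, ← pow_add]
          congr 1
          ring
  obtain ⟨K, NT, hNT, hTN⟩ := exists_isTame_dist T
  have hNL := isTame_toLp (d := d) p.conjExponent
  set NL := fun g : 𝓢(Space d, ℂ) => ‖g.toLp p.conjExponent volume‖ with hNLdef
  obtain ⟨B₁, hB₁, h₁⟩ := hNT.exists_residual_le hφ
  obtain ⟨B₂, hB₂, h₂⟩ := hNL.exists_residual_le hφ
  have hexp : ∀ B : ℝ, 1 ≤ B → ∃ m : ℕ, B * (1 / 2) ^ m ≤ 1 / 2 := fun B hB => by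
    have hB0 : 0 < B := zero_lt_one.trans_le hB
    obtain ⟨m, hm⟩ := exists_pow_lt_of_lt_one (y := (1 / 2 : ℝ)) (x := 1 / 2 / B)
      (by positivity) (by norm_num)
    refine ⟨m, ?_⟩
    rw [mul_comm]
    exact ((lt_div_iff₀ hB0).1 hm).le
  obtain ⟨m₁, hm₁⟩ := hexp B₁ hB₁
  -- enough derivatives to absorb the loss of `ε_j^{-σ}` in the mollifications
  obtain ⟨m₂, hm₂⟩ := hexp (2 ^ σ * B₂)
    (one_le_mul_of_one_le_of_one_le (one_le_pow₀ (by norm_num)) hB₂)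
  obtain ⟨C₁, hC₁, h₁⟩ := h₁ m₁
  obtain ⟨C₂, hC₂, h₂⟩ := h₂ m₂
  set D := 2 * (C * 2 ^ σ * C₂) with hD
  have hD0 : 0 ≤ D := by positivity
  have main : ∀ g, ‖T g‖ ≤ D * iteratedNorm NL m₂ g := by
    intro g
    have hJ := hNL.iteratedNorm_nonneg m₂ g
    set a := C * 2 ^ σ * C₂ * iteratedNorm NL m₂ g with ha
    have ha0 : 0 ≤ a := by positivity
    -- the `j`-th term of the telescoping series for `T g`
    have hstep : ∀ j, ‖T (correlation (deltaNet φ (ε j)) (residual φ ε j g))‖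
        ≤ a * (1 / 2) ^ j := by
      intro j
      refine (norm_dist_correlation_deltaNet_le hp φ (by positivity) (hbound j) _).trans ?_
      calc C * 2 ^ σ * (2 ^ σ) ^ j * NL (residual φ ε j g)
          ≤ C * 2 ^ σ * (2 ^ σ) ^ j * (C₂ * (B₂ * (1 / 2) ^ m₂) ^ j * iteratedNorm NL m₂ g) := by
            gcongr; exact h₂ ε hεle j g
        _ = a * (2 ^ σ * B₂ * (1 / 2) ^ m₂) ^ j := by
            rw [ha, mul_assoc ((2 : ℝ) ^ σ) B₂, mul_pow ((2 : ℝ) ^ σ)]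
            ring
        _ ≤ a * (1 / 2) ^ j := by gcongr
    have htel : ∀ n, ‖T g‖ ≤ ‖T (residual φ ε n g)‖ + ∑ j ∈ Finset.range n, a * (1 / 2) ^ j := by
      intro n
      induction n with
      | zero => simp [residual]
      | succ n ih =>
        rw [Finset.sum_range_succ]
        have h3 : T (residual φ ε n g) = T (residual φ ε (n + 1) g)
            + T (correlation (deltaNet φ (ε n)) (residual φ ε n g)) := by
          rw [residual, map_sub, sub_add_cancel]
        have h4 := norm_add_le (T (residual φ ε (n + 1) g))
          (T (correlation (deltaNet φ (ε n)) (residual φ ε n g)))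
        rw [← h3] at h4
        linarith [hstep n]
    have hsum : ∀ n, ∑ j ∈ Finset.range n, a * (1 / 2 : ℝ) ^ j ≤ 2 * a := fun n => by
      rw [← Finset.mul_sum, mul_comm 2 a]
      gcongr
      exact sum_geometric_two_le n
    have hJ₁ := hNT.iteratedNorm_nonneg m₁ g
    have hres : ∀ n, ‖T g‖ ≤ C₁ * iteratedNorm NT m₁ g * (1 / 2) ^ n + 2 * a := by
      intro n
      have h5 : ‖T (residual φ ε n g)‖ ≤ C₁ * iteratedNorm NT m₁ g * (1 / 2) ^ n := by
        refine ((hTN _).trans (h₁ ε hεle n g)).trans ?_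
        have hB₁0 : 0 ≤ B₁ := zero_le_one.trans hB₁
        calc C₁ * (B₁ * (1 / 2) ^ m₁) ^ n * iteratedNorm NT m₁ g
            ≤ C₁ * (1 / 2) ^ n * iteratedNorm NT m₁ g := by gcongr
          _ = _ := by ring
      linarith [htel n, hsum n]
    have hlim : Tendsto (fun n : ℕ => C₁ * iteratedNorm NT m₁ g * (1 / 2 : ℝ) ^ n + 2 * a) atTop
        (𝓝 (C₁ * iteratedNorm NT m₁ g * 0 + 2 * a)) :=
      ((tendsto_pow_atTop_nhds_zero_of_lt_one (by norm_num) (by norm_num)).const_mul _).add_const _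
    have := ge_of_tendsto' hlim hres
    calc ‖T g‖ ≤ 2 * a := by simpa using this
      _ = _ := by rw [ha, hD]; ring
  -- `iteratedNorm` sums over at most `(d + 1) ^ m₂` derivatives, `sobolevNorm` is a maximum
  refine ⟨m₂, D.toNNReal * (d + 1) ^ m₂, fun g => ?_⟩
  calc ‖T g‖ₑ = ENNReal.ofReal ‖T g‖ := (ofReal_norm _).symm
    _ ≤ ENNReal.ofReal (D * iteratedNorm NL m₂ g) := ENNReal.ofReal_le_ofReal (main g)
    _ = ENNReal.ofReal D * ENNReal.ofReal (iteratedNorm NL m₂ g) := ENNReal.ofReal_mul hD0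
    _ ≤ ENNReal.ofReal D * ((d + 1) ^ m₂ * sobolevNorm m₂ p.conjExponent univ g) := by
        gcongr
        exact iteratedNorm_toLp_le _ m₂ g
    _ = _ := by
        rw [← mul_assoc]
        push_cast
        rfl

/-- A tempered distribution whose mollifications are negligible vanishes. -/
lemma eq_zero_of_mollify_mem_negligible {p q : ℝ≥0∞} (hp : 1 ≤ p) [hq : Fact (1 ≤ q)]
    {φ : 𝓢(Space d, ℂ)} (hφ : ∫ x, φ x = 1) {T : 𝓢'(Space d, ℂ)}
    (hT : mollify φ T ∈ negligible d p q) : T = 0 := by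
  have hp' := fact_one_le_conjExponent p
  have hgrowth : growth q (-1) (fun ε => sobolevNorm 0 p univ (mollify φ T ε)) < ∞ := by
    have h := (Submodule.mem_iInf _).1 ((Submodule.mem_iInf _).1 hT 0) (-1)
    exact h.2
  obtain ⟨C, hC⟩ := exists_dyadic_scale hq.out hgrowth
  choose ε hε1 hε2 hε3 using hC
  obtain ⟨K, NT, hNT, hTN⟩ := exists_isTame_dist T
  ext g
  set D := ∫ z, (1 + ‖z‖) ^ (K + 1) * ‖φ z‖
  set S := ∑ i : Fin d, NT (∂_{dir i} g)
  have hD : 0 ≤ D := integral_nonneg fun z => by positivity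
  have hS : 0 ≤ S := Finset.sum_nonneg fun i _ => hNT.nonneg _
  have hbd : ∀ j, ‖T g‖ ≤ (D * S + C * ‖g.toLp p.conjExponent volume‖) * (1 / 2) ^ j := by
    intro j
    have h1 : ‖T (g - correlation (deltaNet φ (ε j)) g)‖ ≤ D * (ε j * S) :=
      (hTN _).trans (hNT.sub_correlation_deltaNet_le hφ g (ε j))
    have h2 : ‖T (correlation (deltaNet φ (ε j)) g)‖
        ≤ C * ε j * ‖g.toLp p.conjExponent volume‖ := by
      have hε0 : (0 : ℝ) ≤ ε j := (ε j).2.1.le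
      refine norm_dist_correlation_deltaNet_le hp φ (by positivity) ?_ g
      refine (hε3 j).trans (le_of_eq ?_)
      rw [ENNReal.ofReal_mul C.coe_nonneg, ENNReal.ofReal_coe_nnreal, neg_neg, Real.rpow_one]
    have h3 : ‖T g‖ ≤ ‖T (g - correlation (deltaNet φ (ε j)) g)‖
        + ‖T (correlation (deltaNet φ (ε j)) g)‖ := by
      refine le_trans (le_of_eq ?_) (norm_add_le _ _)
      rw [map_sub, sub_add_cancel]
    calc ‖T g‖ ≤ (D * S + C * ‖g.toLp p.conjExponent volume‖) * ε j := by linarith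
      _ ≤ _ := by gcongr; exact (hε2 j).le
  have hlim : Tendsto (fun j : ℕ =>
      (D * S + C * ‖g.toLp p.conjExponent volume‖) * (1 / 2 : ℝ) ^ j) atTop
      (𝓝 ((D * S + C * ‖g.toLp p.conjExponent volume‖) * 0)) :=
    (tendsto_pow_atTop_nhds_zero_of_lt_one (by norm_num) (by norm_num)).const_mul _
  have h0 := ge_of_tendsto' hlim hbd
  rw [mul_zero] at h0
  exact norm_le_zero_iff.1 h0

lemma embedsByMollification_DPrimeLp {p q : ℝ≥0∞} (hp : 1 ≤ p) [hq : Fact (1 ≤ q)]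
    {φ : 𝓢(Space d, ℂ)} (hφ : ∫ x, φ x = 1) : EmbedsByMollification φ p q (DPrimeLp d p) := by
  refine ⟨fun T hT => mollify_mem_moderate hp φ hT, ?_⟩
  rw [← LinearMap.ker_eq_bot, LinearMap.ker_eq_bot']
  rintro ⟨T, hT⟩ h
  have hneg : mollify φ T ∈ negligible d p q := by
    have h1 := (Submodule.Quotient.mk_eq_zero (negligibleInModerate d p q)).1 h
    exact h1
  exact Subtype.ext (eq_zero_of_mollify_mem_negligible hp hφ hneg)

end QColombeau

end

theorem mainTheorem7 (d : ℕ) (p q : ℝ≥0∞) (hp : 1 ≤ p) [hq : Fact (1 ≤ q)]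
    (φ : 𝓢(QColombeau.Space d, ℂ)) (hφ : QColombeau.IsMollifier φ) :
    (∀ T : 𝓢'(QColombeau.Space d, ℂ),
      QColombeau.mollify φ T ∈ QColombeau.moderate d p q → T ∈ QColombeau.DPrimeLp d p) ∧
    IsGreatest {V : Submodule ℂ 𝓢'(QColombeau.Space d, ℂ) |
      QColombeau.EmbedsByMollification φ p q V} (QColombeau.DPrimeLp d p) := by
  have h : ∀ T : 𝓢'(QColombeau.Space d, ℂ),
      QColombeau.mollify φ T ∈ QColombeau.moderate d p q → T ∈ QColombeau.DPrimeLp d p :=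
    fun T hT => QColombeau.mem_DPrimeLp_of_mollify_mem_moderate hp hφ.integral_eq_one hT
  exact ⟨h, QColombeau.embedsByMollification_DPrimeLp hp hφ.integral_eq_one,
    fun V hV T hT => h T (hV.1 T hT)⟩
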